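/- Let $F$ be a field of characteristic $p$, where characteristic $0$ is written $p=\infty$. Let $S_n$ be the symmetric group, with permutations composed from left to right. For a composition $q=(q_1,\dots,q_k)$ of $n$ let $S_q=S_{q_1}\times\cdots\times S_{q_k}\le S_n$ be the Young subgroup, and let $\Xi^q\in F S_n$ be the sum of the minimal length representatives of the right cosets of $S_q$ in $S_n$. The elements $\Xi^q$, for $q$ running over the compositions of $n$, are a basis of a subalgebra $\mathscr D_n(F)$ of $FS_n$, the descent algebra. For $s\ge 1$ let $\Delta_s:\mathscr D_{n+s}(F)\to\mathscr D_n(F)$ be the algebra homomorphism with $\Delta_s(\Xi^q)=\sum_{i:\,q_i\ge s}\Xi^{q^{(i)}}$, where $q^{(i)}$ is obtained from $q$ by replacing $q_i$ by $q_i-s$ and deleting this entry if it is $0$. For a partition $\mu$ of $n$ let $\varphi^q(\mu)$ be the number of right cosets of $S_q$ in $S_n$ that are fixed by (right multiplication with) a permutation of cycle type $\mu$, and let $M_{\mu,F}$ be the one-dimensional $\mathscr D_n(F)$-module on which $\Xi^q$ acts as the scalar $\varphi^q(\mu)\cdot 1_F$. A partition is $p$-regular if each part occurs at most $p-1$ times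 (no condition if $p=\infty$). Partitions $\lambda,\mu$ of $n$ are $p$-equivalent if the $p'$-parts of permutations of cycle types $\lambda$ and $\mu$ are conjugate in $S_n$ (for $p=\infty$: if $\lambda=\mu$). **Theorem.** Let $s\ge 1$. For every $n\ge 0$ and every $p$-regular partition $\mu$ of $n$ there is exactly one $p$-regular partition $\mu^{\#s}$ of $n+s$ that is $p$-equivalent to the partition obtained from $\mu$ by appending a part $s$. The modules $M_{\mu,F}$ and $M_{\mu^{\#s},F}$ are simple, and the pullback of $M_{\mu,F}$ along $\Delta_s$ is isomorphic to $M_{\mu^{\#s},F}$ as a $\mathscr D_{n+s}(F)$-module. Moreover, the map $\mu\mapsto\mu^{\#s}$ on the set of all $p$-regular partitions (of all $n\ge 0$) is injective. -/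

import Mathlib

/-!
Descent algebras of symmetric groups over a commutative ring, the Young characters, the
simple modules, and the Bergeron-Garsia-Reutenauer map.  Permutations of `n` letters are
`Equiv.Perm (Fin n)`; they are multiplied from left to right, that is, in the opposite group
`(Equiv.Perm (Fin n))ᵐᵒᵖ` of Mathlib's group of permutations.
-/

namespace Descent

open Finset MulOpposite

/-! ### The elements `Ξ^q` -/

/-- The length of a permutation: its number of inversions. -/
def length {n : ℕ} (w : Equiv.Perm (Fin n)) : ℕ :=
  #{x : Fin n × Fin n | x.1 < x.2 ∧ w x.2 < w x.1}

/-- The Young subgroup of a composition `q`: the permutations that preserve every block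
`[q₁ + ⋯ + qᵢ₋₁ + 1, q₁ + ⋯ + qᵢ]`.  (`q.index x` is the number of the block of `x`.) -/
def youngSubgroup {n : ℕ} (q : Composition n) : Subgroup (Equiv.Perm (Fin n)) where
  carrier := {h | ∀ x, q.index (h x) = q.index x}
  one_mem' := fun _ => rfl
  mul_mem' := fun {a b} ha hb x => (ha (b x)).trans (hb x)
  inv_mem' := fun {a} ha x => by
    have h : q.index (a (a⁻¹ x)) = q.index (a⁻¹ x) := ha (a⁻¹ x)
    have e : a (a⁻¹ x) = x := Equiv.apply_symm_apply a x
    rw [e] at h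
    exact h.symm

/-- `w` has minimal length in its coset of the Young subgroup of `q`.  With products read from
left to right this is the right coset of `w`, in Mathlib's notation `w * youngSubgroup q`. -/
def IsMinimal {n : ℕ} (q : Composition n) (w : Equiv.Perm (Fin n)) : Prop :=
  ∀ h ∈ youngSubgroup q, length w ≤ length (w * h)

open Classical in
/-- `Ξ^q`: the sum, in the group algebra, of the minimal length representatives of the right
cosets of the Young subgroup of `q`. -/
noncomputable def Xi (R : Type*) [CommRing R] {n : ℕ} (q : Composition n) :
    MonoidAlgebra R (Equiv.Perm (Fin n))ᵐᵒᵖ :=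
  ∑ w : Equiv.Perm (Fin n) with IsMinimal q w, MonoidAlgebra.of R _ (op w)

/-! ### Minimal representatives and words -/

theorem index_mono {n : ℕ} (q : Composition n) : Monotone q.index := by
  intro x y hxy
  by_contra hlt
  rw [not_le] at hlt
  have h1 := q.lt_sizeUpTo_index_succ y
  have h2 := q.sizeUpTo_index_le x
  have h3 : q.sizeUpTo (q.index y).succ ≤ q.sizeUpTo (q.index x) := by
    apply q.monotone_sizeUpTo
    simpa [Nat.succ_le_iff] using hlt
  have h4 : (x : ℕ) ≤ y := hxy
  simp only [Fin.val_succ] at h1 h3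
  omega

/-- The number of occurrences of each letter in a word. -/
def content {n : ℕ} {L : Type*} [DecidableEq L] (f : Fin n → L) (l : L) : ℕ :=
  #{x | f x = l}

theorem content_index {n : ℕ} (q : Composition n) : content q.index = q.blocksFun := by
  funext i
  unfold content
  have : (univ.filter fun x => q.index x = i) = univ.map (q.embedding i).toEmbedding := by
    ext x
    simp only [mem_filter, mem_univ, true_and, mem_map]
    constructor
    · rintro rfl
      exact ⟨q.invEmbedding x, q.embedding_comp_inv x⟩
    · rintro ⟨j, rfl⟩
      exact q.index_embedding i j
  rw [this, card_map, card_univ, Fintype.card_fin]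

theorem content_comp_perm {n : ℕ} {L : Type*} [DecidableEq L] (f : Fin n → L)
    (w : Equiv.Perm (Fin n)) : content (f ∘ w) = content f := by
  funext l
  unfold content
  refine card_bij (fun x _ => w x) ?_ ?_ ?_
  · intro x hx; simpa using hx
  · intro x _ y _ h; exact w.injective h
  · intro y hy; exact ⟨w⁻¹ y, by simpa using hy, by simp⟩

theorem exists_perm_of_content {n : ℕ} {L : Type*} [DecidableEq L] {f g : Fin n → L}
    (h : content f = content g) : ∃ w : Equiv.Perm (Fin n), g ∘ w = f := by
  have e : ∀ l, {x // f x = l} ≃ {x // g x = l} := fun l => by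
    refine Fintype.equivOfCardEq ?_
    rw [Fintype.card_subtype, Fintype.card_subtype]
    exact congrFun h l
  exact ⟨Equiv.ofFiberEquiv e, funext fun x => Equiv.ofFiberEquiv_map e x⟩

theorem comp_sort_of_content {n : ℕ} (q : Composition n) {f : Fin n → Fin q.length}
    (h : content f = q.blocksFun) : f ∘ Tuple.sort f = q.index := by
  rw [← content_index] at h
  obtain ⟨w, hw⟩ := exists_perm_of_content h.symm
  rw [← hw]
  refine Tuple.unique_monotone (Tuple.monotone_sort f) ?_
  rw [hw]
  exact index_mono q

/-- `w` is increasing on every block of `q`. -/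
def Inc {n : ℕ} (q : Composition n) (w : Equiv.Perm (Fin n)) : Prop :=
  ∀ i j, i < j → q.index i = q.index j → w i < w j

theorem inc_iff {n : ℕ} (q : Composition n) (w : Equiv.Perm (Fin n)) :
    Inc q w ↔ w = Tuple.sort (q.index ∘ w.symm) := by
  rw [Tuple.eq_sort_iff]
  have : (q.index ∘ w.symm) ∘ w = q.index := by funext x; simp
  rw [this]
  simp only [Function.comp_apply, Equiv.symm_apply_apply]
  exact ⟨fun h => ⟨index_mono q, h⟩, fun h => h.2⟩

theorem inc_sort {n : ℕ} (q : Composition n) {f : Fin n → Fin q.length}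
    (h : content f = q.blocksFun) : Inc q (Tuple.sort f) := by
  intro i j hij hq
  have h1 := (Tuple.eq_sort_iff (f := f) (σ := Tuple.sort f)).1 rfl
  have h2 := comp_sort_of_content q h
  refine h1.2 i j hij ?_
  have hi := congrFun h2 i
  have hj := congrFun h2 j
  simp only [Function.comp_apply] at hi hj
  rw [hi, hj, hq]

/-- The inversions between different blocks. -/
def outer {n : ℕ} (q : Composition n) (w : Equiv.Perm (Fin n)) : ℕ :=
  #{x : Fin n × Fin n | (x.1 < x.2 ∧ w x.2 < w x.1) ∧ q.index x.1 ≠ q.index x.2}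

theorem outer_le {n : ℕ} (q : Composition n) (w : Equiv.Perm (Fin n)) :
    outer q w ≤ length w :=
  card_le_card fun x hx => by
    simp only [mem_filter, mem_univ, true_and] at hx ⊢
    exact hx.1

theorem inc_iff_outer {n : ℕ} (q : Composition n) (w : Equiv.Perm (Fin n)) :
    Inc q w ↔ length w ≤ outer q w := by
  constructor
  · intro h
    refine card_le_card fun x hx => ?_
    simp only [mem_filter, mem_univ, true_and] at hx ⊢
    exact ⟨hx, fun he => (h _ _ hx.1 he).not_gt hx.2⟩
  · intro h i j hij hq
    by_contra hlt
    have hne : w i ≠ w j := fun he => hij.ne (w.injective he)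
    have hji : w j < w i := lt_of_le_of_ne (not_lt.1 hlt) hne.symm
    refine absurd h (not_le.2 (card_lt_card ?_))
    refine ⟨fun x hx => ?_, fun hsub => ?_⟩
    · simp only [mem_filter, mem_univ, true_and] at hx ⊢
      exact hx.1
    · have := @hsub (i, j) (by simp [hij, hji])
      simp [hq] at this

theorem outer_mul_le {n : ℕ} (q : Composition n) (w h : Equiv.Perm (Fin n))
    (hh : h ∈ youngSubgroup q) : outer q (w * h) ≤ outer q w := by
  have hx' : ∀ x, q.index (h x) = q.index x := hh
  refine card_le_card_of_injOn (fun x => (h x.1, h x.2)) ?_ ?_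
  · intro x hx
    rw [mem_coe, mem_filter] at hx ⊢
    simp only [mem_univ, true_and, Equiv.Perm.coe_mul, Function.comp_apply] at hx ⊢
    obtain ⟨⟨h1, h2⟩, h3⟩ := hx
    refine ⟨⟨?_, h2⟩, by rwa [hx', hx']⟩
    by_contra hle
    have h4 := index_mono q (not_lt.1 hle)
    rw [hx', hx'] at h4
    exact h3 (le_antisymm (index_mono q h1.le) h4)
  · rintro ⟨a, b⟩ _ ⟨c, d⟩ _ hab
    simpa using hab

theorem isMinimal_iff {n : ℕ} (q : Composition n) (w : Equiv.Perm (Fin n)) :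
    IsMinimal q w ↔ Inc q w := by
  constructor
  · intro hmin
    set f : Fin n → Fin q.length := q.index ∘ w.symm with hf
    have hc : content f = q.blocksFun := by
      rw [hf, content_comp_perm, content_index]
    set u := Tuple.sort f with hu
    have hfu : f ∘ u = q.index := comp_sort_of_content q hc
    have hmem : w⁻¹ * u ∈ youngSubgroup q := fun x => congrFun hfu x
    have h1 := hmin _ hmem
    rw [mul_inv_cancel_left] at h1
    have h2 := (inc_iff_outer q u).1 (inc_sort q hc)
    have h3 := outer_mul_le q w _ hmem
    rw [mul_inv_cancel_left] at h3
    exact (inc_iff_outer q w).2 (h1.trans (h2.trans h3))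
  · intro hinc h hh
    have h1 := outer_mul_le q (w * h) h⁻¹ (inv_mem hh)
    rw [mul_inv_cancel_right] at h1
    exact ((inc_iff_outer q w).1 hinc).trans (h1.trans (outer_le q _))

/-- The element of the group algebra given by the standardization of a word. -/
noncomputable def std (R : Type*) [CommRing R] {n : ℕ} {L : Type*} [LinearOrder L]
    (f : Fin n → L) : MonoidAlgebra R (Equiv.Perm (Fin n))ᵐᵒᵖ :=
  MonoidAlgebra.of R _ (op (Tuple.sort f))

theorem Xi_eq (R : Type*) [CommRing R] {n : ℕ} (q : Composition n) :
    Xi R q = ∑ f : Fin n → Fin q.length with content f = q.blocksFun, std R f := by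
  classical
  unfold Xi std
  refine sum_bij' (fun w _ => q.index ∘ w.symm) (fun f _ => Tuple.sort f) ?_ ?_ ?_ ?_ ?_
  · intro w _
    simp only [mem_filter, mem_univ, true_and]
    rw [content_comp_perm, content_index]
  · intro f hf
    simp only [mem_filter, mem_univ, true_and] at hf ⊢
    exact (isMinimal_iff q _).2 (inc_sort q hf)
  · intro w hw
    simp only [mem_filter, mem_univ, true_and] at hw
    exact ((inc_iff q w).1 ((isMinimal_iff q w).1 hw)).symm
  · intro f hf
    simp only [mem_filter, mem_univ, true_and] at hf
    rw [← comp_sort_of_content q hf]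
    funext x
    simp
  · intro w hw
    simp only [mem_filter, mem_univ, true_and] at hw
    rw [← (inc_iff q w).1 ((isMinimal_iff q w).1 hw)]

/-! ### Products of sums over words -/

open Classical in
/-- The matrices with given row and column sums (and entries at most `N`). -/
noncomputable def box {L K : Type*} [Fintype L] [Fintype K] (N : ℕ) (r : L → ℕ) (q : K → ℕ) :
    Finset (L ×ₗ K → ℕ) :=
  {A ∈ Fintype.piFinset fun _ : L ×ₗ K => range (N + 1) |
    (∀ l, ∑ k, A (toLex (l, k)) = r l) ∧ ∀ k, ∑ l, A (toLex (l, k)) = q k}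

theorem sum_box {L K : Type*} [Fintype L] [Fintype K] {N : ℕ} {r : L → ℕ} {q : K → ℕ}
    {A : L ×ₗ K → ℕ} (hA : A ∈ box N r q) : ∑ x, A x = ∑ l, r l := by
  unfold box at hA
  rw [mem_filter] at hA
  calc ∑ x, A x = ∑ x : L × K, A (toLex x) := (Equiv.sum_comp toLex A).symm
    _ = ∑ l, ∑ k, A (toLex (l, k)) := Fintype.sum_prod_type _
    _ = _ := sum_congr rfl fun l _ => hA.2.1 l

open Classical in
theorem conv {L K T₁ T₂ T₃ B : Type*} [Fintype L] [Fintype K] [Fintype T₁] [Fintype T₂]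
    [Fintype T₃] [Semiring B] (c₁ : T₁ → L → ℕ) (c₂ : T₂ → K → ℕ) (c₃ : T₃ → L ×ₗ K → ℕ)
    (v₁ : T₁ → B) (v₂ : T₂ → B) (v₃ : T₃ → B) (e : T₁ × T₂ ≃ T₃) (N : ℕ)
    (hv : ∀ t u, v₁ t * v₂ u = v₃ (e (t, u)))
    (h₁ : ∀ t u l, ∑ k, c₃ (e (t, u)) (toLex (l, k)) = c₁ t l)
    (h₂ : ∀ t u k, ∑ l, c₃ (e (t, u)) (toLex (l, k)) = c₂ u k)
    (hN : ∀ t x, c₃ t x ≤ N) (r : L → ℕ) (q : K → ℕ) :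
    (∑ t with c₁ t = r, v₁ t) * (∑ t with c₂ t = q, v₂ t) =
      ∑ A ∈ box N r q, ∑ t with c₃ t = A, v₃ t := by
  have h3 : ∀ t u, c₃ (e (t, u)) ∈ box N r q ↔ c₁ t = r ∧ c₂ u = q := by
    intro t u
    unfold box
    rw [mem_filter, Fintype.mem_piFinset]
    simp only [h₁, h₂, mem_range, Nat.lt_succ_iff, hN, implies_true, true_and, funext_iff]
  have h4 : ∑ A ∈ box N r q, ∑ t with c₃ t = A, v₃ t = ∑ t with c₃ t ∈ box N r q, v₃ t := by
    rw [← sum_fiberwise_of_maps_to (s := {t | c₃ t ∈ box N r q}) (t := box N r q) (g := c₃)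
      (fun t ht => (mem_filter.1 ht).2)]
    refine sum_congr rfl fun A hA => sum_congr ?_ fun _ _ => rfl
    ext t
    simp only [mem_filter, mem_univ, true_and]
    exact ⟨fun h => ⟨h ▸ hA, h⟩, fun h => h.2⟩
  rw [h4, sum_mul_sum, ← sum_product']
  refine sum_bij (fun x _ => e x) ?_ ?_ ?_ ?_
  · rintro ⟨t, u⟩ hx
    simp only [mem_product, mem_filter, mem_univ, true_and] at hx ⊢
    exact (h3 t u).2 hx
  · intro x _ y _ h
    exact e.injective h
  · intro y hy
    obtain ⟨⟨t, u⟩, rfl⟩ := e.surjective y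
    simp only [mem_filter, mem_univ, true_and] at hy
    exact ⟨(t, u), by simpa using (h3 t u).1 hy, rfl⟩
  · rintro ⟨t, u⟩ _
    exact hv t u

open Classical in
theorem restrict {L K T₁ T₂ B : Type*} [Fintype T₁] [Fintype T₂] [AddCommMonoid B]
    (e : K → L) (j : T₁ → T₂) (hj : Function.Injective j) (c₁ : T₁ → K → ℕ) (c₂ : T₂ → L → ℕ)
    (v₁ : T₁ → B) (v₂ : T₂ → B) (hv : ∀ t, v₂ (j t) = v₁ t)
    (hc : ∀ t i, c₂ (j t) (e i) = c₁ t i) (h0 : ∀ t, ∀ x ∉ Set.range e, c₂ (j t) x = 0)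
    (hs : ∀ t, (∀ x ∉ Set.range e, c₂ t x = 0) → t ∈ Set.range j)
    (a : L → ℕ) (ha : ∀ x ∉ Set.range e, a x = 0) (b : K → ℕ) (hb : ∀ i, a (e i) = b i) :
    ∑ t with c₂ t = a, v₂ t = ∑ t with c₁ t = b, v₁ t := by
  symm
  refine sum_bij (fun t _ => j t) ?_ ?_ ?_ ?_
  · intro t ht
    simp only [mem_filter, mem_univ, true_and] at ht ⊢
    funext x
    by_cases hx : x ∈ Set.range e
    · obtain ⟨i, rfl⟩ := hx
      rw [hc, hb, ht]
    · rw [h0 t x hx, ha x hx]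
  · intro x _ y _ h
    exact hj h
  · intro y hy
    simp only [mem_filter, mem_univ, true_and] at hy
    obtain ⟨t, rfl⟩ := hs y (fun x hx => by rw [hy]; exact ha x hx)
    refine ⟨t, ?_, rfl⟩
    simp only [mem_filter, mem_univ, true_and]
    funext i
    rw [← hc, hy, hb]
  · intro t _
    exact (hv t).symm

section Words

variable {n : ℕ} {L K : Type*} [LinearOrder L] [LinearOrder K]

/-- The product of two words. -/
def wordMul (f : Fin n → L) (g : Fin n → K) (x : Fin n) : L ×ₗ K :=
  toLex (f ((Tuple.sort g).symm x), g x)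

theorem sort_wordMul (f : Fin n → L) (g : Fin n → K) :
    Tuple.sort (wordMul f g) = Tuple.sort g * Tuple.sort f := by
  symm
  have hf := (Tuple.eq_sort_iff (f := f) (σ := Tuple.sort f)).1 rfl
  have hg := (Tuple.eq_sort_iff (f := g) (σ := Tuple.sort g)).1 rfl
  have key : ∀ i, wordMul f g ((Tuple.sort g * Tuple.sort f) i) =
      toLex (f (Tuple.sort f i), g (Tuple.sort g (Tuple.sort f i))) := by
    intro i
    simp [wordMul]
  rw [Tuple.eq_sort_iff]
  constructor
  · intro i j hij
    rcases hij.eq_or_lt with rfl | hlt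
    · exact le_rfl
    · simp only [Function.comp_apply]
      rw [key, key, Prod.Lex.toLex_le_toLex]
      rcases (hf.1 hij).lt_or_eq with h | h
      · exact Or.inl h
      · exact Or.inr ⟨h, hg.1 (hf.2 i j hlt h).le⟩
  · intro i j hij h
    rw [key, key] at h
    have h' := Prod.ext_iff.1 (toLex.injective h)
    exact hg.2 _ _ (hf.2 i j hij h'.1) h'.2

theorem std_mul (R : Type*) [CommRing R] (f : Fin n → L) (g : Fin n → K) :
    std R f * std R g = std R (wordMul f g) := by
  unfold std
  rw [sort_wordMul, ← map_mul, op_mul]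

/-- Pairs of words are words in pairs. -/
def wordEquiv : (Fin n → L) × (Fin n → K) ≃ (Fin n → L ×ₗ K) where
  toFun p := wordMul p.1 p.2
  invFun h := (fun x => (ofLex (h (Tuple.sort (fun y => (ofLex (h y)).2) x))).1,
    fun y => (ofLex (h y)).2)
  left_inv := by
    rintro ⟨f, g⟩
    simp [wordMul]
  right_inv := by
    intro h
    funext x
    simp [wordMul]

theorem content_le {M : Type*} [DecidableEq M] (f : Fin n → M) (l : M) : content f l ≤ n := by
  unfold content
  exact (card_le_univ _).trans (by simp)

theorem sum_content {M : Type*} [DecidableEq M] [Fintype M] (f : Fin n → M) :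
    ∑ l, content f l = n := by
  unfold content
  rw [← card_eq_sum_card_fiberwise (fun _ _ => by simp)]
  simp

theorem sum_content_right [Fintype K] (f : Fin n → L) (g : Fin n → K) (l : L) :
    ∑ k, content (fun x => toLex (f x, g x)) (toLex (l, k)) = content f l := by
  unfold content
  rw [card_eq_sum_card_fiberwise (f := g) (t := univ) (fun _ _ => by simp)]
  refine sum_congr rfl fun k _ => ?_
  rw [filter_filter]
  congr 1
  ext x
  simp only [mem_filter, mem_univ, true_and, EmbeddingLike.apply_eq_iff_eq, Prod.mk.injEq]

theorem sum_content_left [Fintype L] (f : Fin n → L) (g : Fin n → K) (k : K) :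
    ∑ l, content (fun x => toLex (f x, g x)) (toLex (l, k)) = content g k := by
  unfold content
  rw [card_eq_sum_card_fiberwise (f := f) (t := univ) (fun _ _ => by simp)]
  refine sum_congr rfl fun l _ => ?_
  rw [filter_filter]
  congr 1
  ext x
  simp only [mem_filter, mem_univ, true_and, EmbeddingLike.apply_eq_iff_eq, Prod.mk.injEq,
    and_comm]

theorem sort_comp {f : Fin n → K} (e : K ↪o L) : Tuple.sort (e ∘ f) = Tuple.sort f := by
  symm
  have hf := (Tuple.eq_sort_iff (f := f) (σ := Tuple.sort f)).1 rfl
  rw [Tuple.eq_sort_iff]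
  refine ⟨fun i j hij => e.monotone (hf.1 hij), fun i j hij h => hf.2 i j hij (e.injective h)⟩

theorem content_comp {f : Fin n → K} (e : K ↪o L) (i : K) :
    content (e ∘ f) (e i) = content f i := by
  simp [content]

theorem content_comp_zero {f : Fin n → K} (e : K ↪o L) (x : L) (hx : x ∉ Set.range e) :
    content (e ∘ f) x = 0 := by
  simp only [content, card_eq_zero, filter_eq_empty_iff, mem_univ, true_implies]
  exact fun y h => hx ⟨_, h⟩

theorem exists_comp (e : K ↪o L) (f : Fin n → L) (h : ∀ x ∉ Set.range e, content f x = 0) :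
    ∃ g : Fin n → K, e ∘ g = f := by
  have : ∀ y, ∃ k, e k = f y := by
    intro y
    by_contra hy
    have := h (f y) (fun ⟨k, hk⟩ => hy ⟨k, hk⟩)
    simp only [content, card_eq_zero, filter_eq_empty_iff, mem_univ, true_implies] at this
    exact this rfl
  choose g hg using this
  exact ⟨g, funext hg⟩

end Words

/-! ### The three sums -/

section Sums

variable (R : Type*) [CommRing R]

/-- The sum of the words of content `a`. -/
noncomputable def X (n : ℕ) {L : Type*} [LinearOrder L] [Fintype L] (a : L → ℕ) :
    MonoidAlgebra R (Equiv.Perm (Fin n))ᵐᵒᵖ :=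
  ∑ f : Fin n → L with content f = a, std R f

/-- The content of a word in which one letter `l` is counted `s` more times. -/
def contentAdd (s : ℕ) {n : ℕ} {L : Type*} [DecidableEq L] (p : (Fin n → L) × L) (x : L) : ℕ :=
  content p.1 x + if p.2 = x then s else 0

/-- The sum of the words that have content `a` when one letter is counted `s` more times. -/
noncomputable def Y (n s : ℕ) {L : Type*} [LinearOrder L] [Fintype L] (a : L → ℕ) :
    MonoidAlgebra R (Equiv.Perm (Fin n))ᵐᵒᵖ :=
  ∑ p : (Fin n → L) × L with contentAdd s p = a, std R p.1

open Classical in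
/-- The number of `σ`-invariant words of content `a`. -/
noncomputable def Z {n : ℕ} (σ : Equiv.Perm (Fin n)) {L : Type*} [LinearOrder L] [Fintype L]
    (a : L → ℕ) : R :=
  ∑ f : {f : Fin n → L // f ∘ σ = f} with content f.1 = a, 1

variable {L K : Type*} [LinearOrder L] [Fintype L] [LinearOrder K] [Fintype K]

theorem X_mul (n : ℕ) (r : L → ℕ) (q : K → ℕ) (N : ℕ) (hN : n ≤ N) :
    X R n r * X R n q = ∑ A ∈ box N r q, X R n A := by
  classical
  have h := conv (fun f : Fin n → L => content f) (fun f : Fin n → K => content f)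
    (fun f : Fin n → L ×ₗ K => content f) (std R) (std R) (std R) wordEquiv N
    (fun f g => std_mul R f g)
    (fun f g l => (sum_content_right _ g l).trans (by rw [← content_comp_perm f]; rfl))
    (fun f g k => sum_content_left _ g k)
    (fun f x => (content_le f x).trans hN) r q
  unfold X
  convert h

theorem Y_mul (n s : ℕ) (r : L → ℕ) (q : K → ℕ) (N : ℕ) (hN : n + s ≤ N) :
    Y R n s r * Y R n s q = ∑ A ∈ box N r q, Y R n s A := by
  classical
  have e : ∀ l k l' k', ((toLex (l, k) : L ×ₗ K) = toLex (l', k')) ↔ l = l' ∧ k = k' := by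
    intros; simp
  have h := conv (contentAdd s (n := n) (L := L)) (contentAdd s (n := n) (L := K))
    (contentAdd s (n := n) (L := L ×ₗ K)) (fun p => std R p.1) (fun p => std R p.1)
    (fun p => std R p.1)
    ((Equiv.prodProdProdComm _ _ _ _).trans (wordEquiv.prodCongr toLex)) N
    (fun f g => std_mul R f.1 g.1)
    (fun f g l => by
      have h1 := (sum_content_right (f.1 ∘ (Tuple.sort g.1).symm) g.1 l)
      rw [content_comp_perm] at h1
      simp only [contentAdd, sum_add_distrib]
      refine congrArg₂ (· + ·) h1 ?_
      simp [Equiv.prodProdProdComm, ite_and])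
    (fun f g k => by
      have h1 := (sum_content_left (f.1 ∘ (Tuple.sort g.1).symm) g.1 k)
      simp only [contentAdd, sum_add_distrib]
      refine congrArg₂ (· + ·) h1 ?_
      simp [Equiv.prodProdProdComm, ite_and])
    (fun f x => (add_le_add (content_le f.1 x) (by split_ifs <;> simp)).trans hN) r q
  unfold Y
  convert h

theorem Z_mul {n : ℕ} (σ : Equiv.Perm (Fin n)) (r : L → ℕ) (q : K → ℕ) (N : ℕ) (hN : n ≤ N) :
    Z R σ r * Z R σ q = ∑ A ∈ box N r q, Z R σ A := by
  classical
  have h := conv (fun f : {f : Fin n → L // f ∘ σ = f} => content f.1)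
    (fun f : {f : Fin n → K // f ∘ σ = f} => content f.1)
    (fun f : {f : Fin n → L ×ₗ K // f ∘ σ = f} => content f.1)
    (fun _ => (1 : R)) (fun _ => (1 : R)) (fun _ => (1 : R))
    { toFun := fun p => ⟨fun x => toLex (p.1.1 x, p.2.1 x), funext fun x =>
        congrArg toLex (Prod.ext (congrFun p.1.2 x) (congrFun p.2.2 x))⟩
      invFun := fun f => (⟨fun x => (ofLex (f.1 x)).1, funext fun x =>
        congrArg (fun y => (ofLex y).1) (congrFun f.2 x)⟩, ⟨fun x => (ofLex (f.1 x)).2,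
        funext fun x => congrArg (fun y => (ofLex y).2) (congrFun f.2 x)⟩)
      left_inv := fun _ => rfl
      right_inv := fun _ => rfl } N
    (fun _ _ => one_mul 1)
    (fun f g l => sum_content_right f.1 g.1 l)
    (fun f g k => sum_content_left f.1 g.1 k)
    (fun f x => (content_le f.1 x).trans hN) r q
  unfold Z
  convert h

theorem X_restrict (n : ℕ) (e : K ↪o L) (a : L → ℕ) (ha : ∀ x ∉ Set.range e, a x = 0)
    (b : K → ℕ) (hb : ∀ i, a (e i) = b i) : X R n a = X R n b := by
  classical
  have h := restrict e (fun f : Fin n → K => e ∘ f) (e.injective.comp_left)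
    (fun f => content f) (fun f => content f) (std R) (std R)
    (fun f => by unfold std; rw [sort_comp]) (fun f i => content_comp e i)
    (fun f x hx => content_comp_zero e x hx) (fun f hf => exists_comp e f hf) a ha b hb
  unfold X
  convert h

theorem Y_restrict (n s : ℕ) (hs : 0 < s) (e : K ↪o L) (a : L → ℕ)
    (ha : ∀ x ∉ Set.range e, a x = 0)
    (b : K → ℕ) (hb : ∀ i, a (e i) = b i) : Y R n s a = Y R n s b := by
  classical
  have h := restrict e (fun p : (Fin n → K) × K => (e ∘ p.1, e p.2))
    (Function.Injective.prodMap e.injective.comp_left e.injective)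
    (contentAdd s) (contentAdd s) (fun p => std R p.1) (fun p => std R p.1)
    (fun f => by simp only [std]; rw [sort_comp])
    (fun f i => by simp [contentAdd, content_comp])
    (fun f x hx => by
      have : e f.2 ≠ x := fun h => hx ⟨_, h⟩
      simp [contentAdd, content_comp_zero e x hx, this])
    (fun f hf => by
      simp only [contentAdd, Nat.add_eq_zero_iff] at hf
      obtain ⟨g, hg⟩ := exists_comp e f.1 (fun x hx => (hf x hx).1)
      by_cases hk : f.2 ∈ Set.range e
      · obtain ⟨k, hk⟩ := hk
        exact ⟨(g, k), Prod.ext hg hk⟩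
      · have := (hf _ hk).2
        simp at this
        omega) a ha b hb
  unfold Y
  convert h

theorem Z_restrict {n : ℕ} (σ : Equiv.Perm (Fin n)) (e : K ↪o L) (a : L → ℕ)
    (ha : ∀ x ∉ Set.range e, a x = 0)
    (b : K → ℕ) (hb : ∀ i, a (e i) = b i) : Z R σ a = Z R σ b := by
  classical
  have h := restrict e (fun f : {f : Fin n → K // f ∘ σ = f} =>
      (⟨e ∘ f.1, congrArg (e ∘ ·) f.2⟩ : {f : Fin n → L // f ∘ σ = f}))
    (fun f g hfg => Subtype.ext (e.injective.comp_left (congrArg Subtype.val hfg)))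
    (fun f => content f.1) (fun f => content f.1) (fun _ => (1 : R)) (fun _ => (1 : R))
    (fun f => rfl) (fun f i => content_comp e i)
    (fun f x hx => content_comp_zero e x hx) (fun f hf => by
      obtain ⟨g, hg⟩ := exists_comp e f.1 hf
      refine ⟨⟨g, ?_⟩, Subtype.ext hg⟩
      have := f.2
      rw [← hg] at this
      exact e.injective.comp_left this) a ha b hb
  unfold Z
  convert h

end Sums

/-! ### Compositions from sequences with zeros -/

/-- The composition of `n` obtained from `q` (a composition of `n + s`) by subtracting `s` from
the part with index `i`, and removing this part if it has become zero. -/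
def subPart {n s : ℕ} (q : Composition (n + s)) (i : Fin q.length) (h : s ≤ q.blocksFun i) :
    Composition n where
  blocks := (List.ofFn fun j => if j = i then q.blocksFun j - s else q.blocksFun j).filter
    (fun b => 0 < b)
  blocks_pos := fun hb => by simpa using (List.mem_filter.1 hb).2
  blocks_sum := by
    have h1 : ∀ l : List ℕ, (l.filter (fun b => 0 < b)).sum = l.sum := by
      intro l
      induction l with
      | nil => rfl
      | cons a l ih =>
        rw [List.filter_cons, List.sum_cons]
        split_ifs with ha
        · rw [List.sum_cons, ih]
        · rw [ih]
          simp at ha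
          omega
    rw [h1, List.sum_ofFn]
    have h2 : ∑ j, ((if j = i then q.blocksFun j - s else q.blocksFun j) +
        if j = i then s else 0) = n + s := by
      refine Eq.trans ?_ q.sum_blocksFun
      refine sum_congr rfl fun j _ => ?_
      split_ifs with hj
      · subst hj
        omega
      · rfl
    rw [sum_add_distrib, sum_ite_eq' univ i (fun _ => s), if_pos (mem_univ i)] at h2
    omega

theorem zero_off_range {K L : Type*} [Fintype K] [Fintype L] (e : K ↪ L) (a : L → ℕ) (b : K → ℕ)
    (hb : ∀ i, a (e i) = b i) (h : ∑ x, a x = ∑ i, b i) : ∀ x ∉ Set.range e, a x = 0 := by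
  classical
  have h1 : ∑ i, b i = ∑ x ∈ univ.map e, a x := by
    rw [sum_map]
    exact sum_congr rfl fun i _ => (hb i).symm
  have h2 := sum_compl_add_sum (univ.map e) a
  have h3 : ∑ x ∈ (univ.map e)ᶜ, a x = 0 := by omega
  intro x hx
  refine (sum_eq_zero_iff.1 h3) x ?_
  simpa using hx

theorem subPart_embedding {n s : ℕ} (q : Composition (n + s)) (i : Fin q.length)
    (h : s ≤ q.blocksFun i) : ∃ e : Fin (subPart q i h).length ↪o Fin q.length,
      (∀ j, (if e j = i then q.blocksFun (e j) - s else q.blocksFun (e j)) =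
        (subPart q i h).blocksFun j) := by
  set a : Fin q.length → ℕ := fun j => if j = i then q.blocksFun j - s else q.blocksFun j with ha
  have hsub : (subPart q i h).blocks.Sublist (List.ofFn a) := List.filter_sublist
  obtain ⟨f, hf⟩ := List.sublist_iff_exists_fin_orderEmbedding_get_eq.1 hsub
  refine ⟨f.trans (Fin.castOrderIso (List.length_ofFn)).toOrderEmbedding, fun j => ?_⟩
  have h1 := hf j
  rw [List.get_ofFn] at h1
  exact h1.symm

theorem exists_composition {n : ℕ} {L : Type*} [LinearOrder L] [Fintype L] (a : L → ℕ)
    (ha : ∑ x, a x = n) : ∃ (q : Composition n) (e : Fin q.length ↪o L),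
      (∀ i, a (e i) = q.blocksFun i) ∧ ∀ x ∉ Set.range e, a x = 0 := by
  classical
  set S : Finset L := {x | a x ≠ 0} with hS
  set f : Fin #S ↪o L := S.orderEmbOfFin rfl with hf
  have hsum : ∑ i, a (f i) = n := by
    rw [← ha, ← sum_subset (subset_univ S) (f := a)
      (fun x _ hx => by simpa [hS] using hx)]
    rw [← sum_coe_sort S a]
    exact Equiv.sum_comp (S.orderIsoOfFin rfl).toEquiv (fun x : S => a x)
  let q : Composition n :=
    { blocks := List.ofFn fun i => a (f i)
      blocks_pos := fun {b} hb => by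
        obtain ⟨i, rfl⟩ := (List.mem_ofFn' _ _).1 hb
        have := S.orderEmbOfFin_mem rfl i
        simp only [hS, mem_filter, mem_univ, true_and] at this
        exact Nat.pos_of_ne_zero this
      blocks_sum := by rw [List.sum_ofFn]; exact hsum }
  have key : ∀ i, a (((Fin.castOrderIso (List.length_ofFn)).toOrderEmbedding.trans f) i) =
      q.blocksFun i := by
    intro i
    have : q.blocksFun i = q.blocks.get i := rfl
    rw [this, List.get_ofFn]
    rfl
  refine ⟨q, (Fin.castOrderIso (List.length_ofFn)).toOrderEmbedding.trans f, key, ?_⟩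
  exact zero_off_range (RelEmbedding.toEmbedding _) a _ key (by rw [q.sum_blocksFun, ha])

/-! ### Linear independence -/

section Independent

theorem index_surjective {n : ℕ} (q : Composition n) : Function.Surjective q.index := fun i =>
  ⟨q.embedding i ⟨0, q.one_le_blocksFun i⟩, q.index_embedding i _⟩

/-- A permutation whose descents are exactly at the ends of the blocks of `q`. -/
def rep {n : ℕ} (q : Composition n) : Equiv.Perm (Fin n) :=
  (Tuple.sort (OrderDual.toDual ∘ q.index)).symm

theorem rep_lt {n : ℕ} (q : Composition n) {x y : Fin n} (h : x < y) :
    rep q x < rep q y ↔ q.index x = q.index y := by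
  have hs := (Tuple.eq_sort_iff (f := OrderDual.toDual ∘ q.index)
    (σ := Tuple.sort (OrderDual.toDual ∘ q.index))).1 rfl
  set t := Tuple.sort (OrderDual.toDual ∘ q.index) with ht
  have ex : t (rep q x) = x := t.apply_symm_apply x
  have ey : t (rep q y) = y := t.apply_symm_apply y
  constructor
  · intro hlt
    have h1 := hs.1 hlt.le
    simp only [Function.comp_apply, ex, ey, OrderDual.toDual_le_toDual] at h1
    exact le_antisymm (index_mono q h.le) h1
  · intro he
    by_contra hlt
    have hne : rep q y ≠ rep q x := fun h' => h.ne' ((rep q).injective h')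
    have h2 := hs.2 _ _ (lt_of_le_of_ne (not_lt.1 hlt) hne)
      (by simp only [Function.comp_apply, ex, ey, he])
    rw [ex, ey] at h2
    exact h2.not_gt h

theorem inc_rep {n : ℕ} (q r : Composition n) : Inc r (rep q) ↔
    ∀ x y, r.index x = r.index y → q.index x = q.index y := by
  constructor
  · intro h x y hxy
    rcases lt_trichotomy x y with hlt | rfl | hlt
    · exact (rep_lt q hlt).1 (h x y hlt hxy)
    · rfl
    · exact ((rep_lt q hlt).1 (h y x hlt hxy.symm)).symm
  · intro h i j hij hr
    exact (rep_lt q hij).2 (h i j hr)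

theorem eq_of_refines {n : ℕ} (q r : Composition n)
    (h : ∀ x y, r.index x = r.index y → q.index x = q.index y) (hl : r.length ≤ q.length) :
    r = q := by
  choose g hg using index_surjective r
  set φ : Fin r.length → Fin q.length := fun i => q.index (g i) with hφ
  have hφi : ∀ x, φ (r.index x) = q.index x := fun x => h _ _ (hg _)
  have hsurj : Function.Surjective φ := by
    intro j
    obtain ⟨x, rfl⟩ := index_surjective q j
    exact ⟨r.index x, hφi x⟩
  have hlen : r.length = q.length :=
    le_antisymm hl (by simpa using Fintype.card_le_of_surjective φ hsurj)
  have hbij : Function.Bijective φ :=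
    (Fintype.bijective_iff_surjective_and_card φ).2 ⟨hsurj, by simp [hlen]⟩
  have hmono : Monotone φ := by
    intro i j hij
    obtain ⟨x, rfl⟩ := index_surjective r i
    obtain ⟨y, rfl⟩ := index_surjective r j
    rw [hφi, hφi]
    rcases hij.lt_or_eq with hlt | he
    · refine index_mono q ?_
      by_contra hyx
      exact hlt.not_ge (index_mono r (not_le.1 hyx).le)
    · exact (h _ _ he).le
  have hcast : ∀ i, φ i = Fin.cast hlen i := by
    have h1 : (hmono.strictMono_of_injective hbij.1).orderIsoOfSurjective φ hsurj =
      Fin.castOrderIso hlen := Subsingleton.elim _ _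
    intro i
    exact DFunLike.congr_fun h1 i
  refine Composition.ext (List.ext_get (by rw [r.blocks_length, q.blocks_length, hlen]) ?_)
  intro k h1 h2
  have e1 : r.blocks.get ⟨k, h1⟩ = content r.index ⟨k, h1⟩ := by rw [content_index]; rfl
  have e2 : q.blocks.get ⟨k, h2⟩ = content q.index ⟨k, h2⟩ := by rw [content_index]; rfl
  rw [e1, e2]
  unfold content
  congr 1
  ext x
  simp only [mem_filter, mem_univ, true_and]
  rw [← hφi x, hcast]
  simp only [Fin.ext_iff, Fin.val_cast]

theorem coeff_Xi (R : Type*) [CommRing R] {n : ℕ} (r : Composition n) (w : Equiv.Perm (Fin n))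
    [Decidable (Inc r w)] : (Xi R r).coeff (op w) = if Inc r w then 1 else 0 := by
  classical
  unfold Xi
  simp only [MonoidAlgebra.coeff_sum, MonoidAlgebra.of_apply, MonoidAlgebra.coeff_single,
    Finsupp.finsetSum_apply, Finsupp.single_apply, op_inj]
  rw [sum_ite_eq']
  simp [isMinimal_iff]

theorem linearIndependent_Xi (R : Type*) [CommRing R] (n : ℕ) :
    LinearIndependent R (fun q : Composition n => Xi R q) := by
  classical
  rw [Fintype.linearIndependent_iff]
  intro c hc
  have key : ∀ q : Composition n, ∑ r, c r * (if Inc r (rep q) then 1 else 0) = 0 := by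
    intro q
    have h1 := congrArg (fun x => x.coeff (op (rep q))) hc
    simpa [MonoidAlgebra.coeff_sum, Finsupp.finsetSum_apply, coeff_Xi] using h1
  have main : ∀ d : ℕ, ∀ q : Composition n, n ≤ q.length + d → c q = 0 := by
    intro d
    induction d with
    | zero =>
      intro q hq
      have h1 := key q
      rw [sum_eq_single q] at h1
      · rwa [if_pos ((inc_rep q q).2 fun _ _ h => h), mul_one] at h1
      · intro r _ hr
        rw [if_neg, mul_zero]
        intro hi
        exact hr (eq_of_refines q r ((inc_rep q r).1 hi) (r.length_le.trans hq))
      · simp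
    | succ d ih =>
      intro q hq
      have h1 := key q
      rw [sum_eq_single q] at h1
      · rwa [if_pos ((inc_rep q q).2 fun _ _ h => h), mul_one] at h1
      · intro r _ hr
        by_cases hi : Inc r (rep q)
        · have hlt : q.length < r.length := by
            by_contra hle
            exact hr (eq_of_refines q r ((inc_rep q r).1 hi) (not_lt.1 hle))
          rw [ih r (by omega), zero_mul]
        · rw [if_neg hi, mul_zero]
      · simp
  exact fun q => main n q (by omega)

end Independent

/-! ### The descent algebra -/

section Algebra

variable (R : Type*) [CommRing R]

theorem Xi_eq_X {n : ℕ} (q : Composition n) : Xi R q = X R n q.blocksFun := Xi_eq R q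

theorem X_mem {n : ℕ} {L : Type*} [LinearOrder L] [Fintype L] (a : L → ℕ) (ha : ∑ x, a x = n) :
    X R n a ∈ Submodule.span R (Set.range fun q : Composition n => Xi R q) := by
  obtain ⟨q, e, h1, h2⟩ := exists_composition a ha
  rw [X_restrict R n e a h2 _ h1, ← Xi_eq_X]
  exact Submodule.subset_span ⟨q, rfl⟩

theorem one_eq_X (n : ℕ) :
    (1 : MonoidAlgebra R (Equiv.Perm (Fin n))ᵐᵒᵖ) = X R n (fun _ : Fin 1 => n) := by
  classical
  unfold X
  have h1 : ({f | content f = fun _ => n} : Finset (Fin n → Fin 1)) = {fun _ => 0} := by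
    ext f
    have hf : f = fun _ => 0 := Subsingleton.elim _ _
    subst hf
    simp only [mem_filter, mem_univ, true_and, mem_singleton, iff_true]
    funext l
    have : l = 0 := Subsingleton.elim _ _
    subst this
    simp [content]
  have h2 : Tuple.sort (fun _ : Fin n => (0 : Fin 1)) = 1 :=
    Tuple.sort_eq_refl_iff_monotone.2 monotone_const
  rw [h1, sum_singleton, std, h2, op_one, map_one]

theorem one_mem_span (n : ℕ) : (1 : MonoidAlgebra R (Equiv.Perm (Fin n))ᵐᵒᵖ) ∈
    Submodule.span R (Set.range fun q : Composition n => Xi R q) := by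
  rw [one_eq_X]
  exact X_mem R _ (by simp)

theorem mul_mem_span {n : ℕ} {a b : MonoidAlgebra R (Equiv.Perm (Fin n))ᵐᵒᵖ}
    (ha : a ∈ Submodule.span R (Set.range fun q : Composition n => Xi R q))
    (hb : b ∈ Submodule.span R (Set.range fun q : Composition n => Xi R q)) :
    a * b ∈ Submodule.span R (Set.range fun q : Composition n => Xi R q) := by
  refine Submodule.span_induction₂ (p := fun a b _ _ =>
    a * b ∈ Submodule.span R (Set.range fun q : Composition n => Xi R q)) ?_ ?_ ?_ ?_ ?_ ?_ ?_ ha hb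
  · rintro _ _ ⟨r, rfl⟩ ⟨q, rfl⟩
    simp only [Xi_eq_X R r, Xi_eq_X R q]
    rw [X_mul R n _ _ n le_rfl]
    refine Submodule.sum_mem _ fun A hA => X_mem R A ?_
    rw [sum_box hA, r.sum_blocksFun]
  · intro y _
    rw [zero_mul]
    exact Submodule.zero_mem _
  · intro x _
    rw [mul_zero]
    exact Submodule.zero_mem _
  · intro x y z _ _ _ h1 h2
    rw [add_mul]
    exact Submodule.add_mem _ h1 h2
  · intro x y z _ _ _ h1 h2
    rw [mul_add]
    exact Submodule.add_mem _ h1 h2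
  · intro c x y _ _ h
    rw [smul_mul_assoc]
    exact Submodule.smul_mem _ c h
  · intro c x y _ _ h
    rw [mul_smul_comm]
    exact Submodule.smul_mem _ c h

/-- The descent algebra of the symmetric group of degree `n` over `R`: the span of the elements
`Ξ^q` in the group algebra. -/
noncomputable def descentAlgebra (n : ℕ) :
    Subalgebra R (MonoidAlgebra R (Equiv.Perm (Fin n))ᵐᵒᵖ) :=
  (Submodule.span R (Set.range fun q : Composition n => Xi R q)).toSubalgebra
    (one_mem_span R n) (fun _ _ => mul_mem_span R)

/-- The element `Ξ^q` of the descent algebra. -/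
noncomputable def xi {n : ℕ} (q : Composition n) : descentAlgebra R n :=
  ⟨Xi R q, Submodule.subset_span ⟨q, rfl⟩⟩

/-- The basis of the descent algebra formed by the elements `Ξ^q`. -/
noncomputable def xiBasis (n : ℕ) : Module.Basis (Composition n) R (descentAlgebra R n) :=
  Module.Basis.span (linearIndependent_Xi R n)

theorem xiBasis_apply {n : ℕ} (q : Composition n) : xiBasis R n q = xi R q :=
  Module.Basis.span_apply (linearIndependent_Xi R n) q

/-- A linear map on the descent algebra given by a multiplicative rule is multiplicative. -/
theorem constr_mul {n : ℕ} {B : Type*} [Ring B] [Algebra R B] (W : Composition n → B)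
    (V : ∀ {k : ℕ}, (Fin k → ℕ) → B) (V' : ∀ {k l : ℕ}, (Fin k ×ₗ Fin l → ℕ) → B) (N : ℕ)
    (hN : n ≤ N) (hW : ∀ q : Composition n, W q = V q.blocksFun)
    (hV : ∀ {k l : ℕ} (r : Fin k → ℕ) (q : Fin l → ℕ), V r * V q = ∑ A ∈ box N r q, V' A)
    (hV' : ∀ {k l : ℕ} (A : Fin k ×ₗ Fin l → ℕ) (q : Composition n)
      (e : Fin q.length ↪o Fin k ×ₗ Fin l), (∀ i, A (e i) = q.blocksFun i) →
      (∀ x ∉ Set.range e, A x = 0) → V' A = V q.blocksFun)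
    (x y : descentAlgebra R n) :
    (xiBasis R n).constr R W (x * y) = (xiBasis R n).constr R W x * (xiBasis R n).constr R W y := by
  set F := (xiBasis R n).constr R W with hF
  have hFxi : ∀ q, F (xi R q) = V q.blocksFun := by
    intro q
    rw [← hW, ← xiBasis_apply, hF, Module.Basis.constr_basis]
  have hbil : (LinearMap.mul R (descentAlgebra R n)).compr₂ F =
      (LinearMap.mul R B).compl₁₂ F F := by
    refine (xiBasis R n).ext fun r => (xiBasis R n).ext fun q => ?_
    simp only [LinearMap.compr₂_apply, LinearMap.mul_apply', LinearMap.compl₁₂_apply,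
      xiBasis_apply, hFxi, hV]
    have hex : ∀ A : Fin r.length ×ₗ Fin q.length → ℕ, A ∈ box N r.blocksFun q.blocksFun →
        ∃ t : descentAlgebra R n, (t : MonoidAlgebra R (Equiv.Perm (Fin n))ᵐᵒᵖ) = X R n A ∧
          F t = V' A := by
      intro A hA
      obtain ⟨s, e, h1, h2⟩ := exists_composition A ((sum_box hA).trans r.sum_blocksFun)
      refine ⟨xi R s, ?_, ?_⟩
      · rw [X_restrict R n e A h2 _ h1, ← Xi_eq_X]
        rfl
      · rw [hFxi, hV' A s e h1 h2]
    choose! t ht using hex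
    have hprod : xi R r * xi R q = ∑ A ∈ box N r.blocksFun q.blocksFun, t A := by
      apply Subtype.ext
      rw [MulMemClass.coe_mul, AddSubmonoidClass.coe_finsetSum]
      rw [sum_congr rfl fun A hA => (ht A hA).1, ← X_mul R n _ _ N hN, ← Xi_eq_X, ← Xi_eq_X]
      rfl
    rw [hprod, map_sum]
    exact sum_congr rfl fun A hA => (ht A hA).2
  exact LinearMap.congr_fun (LinearMap.congr_fun hbil x) y

end Algebra

/-! ### The Bergeron-Garsia-Reutenauer map -/

section BGR

open CategoryTheory

variable (R : Type*) [CommRing R]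

theorem constr_one {n : ℕ} {B : Type*} [Ring B] [Algebra R B] (W : Composition n → B) (b : B)
    (hW : ∀ (q : Composition n) (e : Fin q.length ↪o Fin 1), (∀ i, n = q.blocksFun i) →
      (∀ x ∉ Set.range e, n = 0) → W q = b) :
    (xiBasis R n).constr R W 1 = b := by
  obtain ⟨q, e, h1, h2⟩ := exists_composition (n := n) (fun _ : Fin 1 => n) (by simp)
  have h3 : (1 : descentAlgebra R n) = xi R q := by
    apply Subtype.ext
    change (1 : MonoidAlgebra R (Equiv.Perm (Fin n))ᵐᵒᵖ) = Xi R q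
    rw [one_eq_X, Xi_eq_X]
    exact X_restrict R n e _ h2 _ h1
  rw [h3, ← xiBasis_apply, Module.Basis.constr_basis]
  exact hW q e h1 h2

/-- The linear map `Δ_s`, with `Δ_s(Ξ^q) = ∑ Ξ^{q^{(i)}}` over the indices `i` with `qᵢ ≥ s`. -/
noncomputable def bgrLinear (n s : ℕ) : descentAlgebra R (n + s) →ₗ[R] descentAlgebra R n :=
  (xiBasis R (n + s)).constr R fun q =>
    ∑ i : {i : Fin q.length // s ≤ q.blocksFun i}, xi R (subPart q i.1 i.2)

theorem bgrLinear_xi (n s : ℕ) (q : Composition (n + s)) : bgrLinear R n s (xi R q) =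
    ∑ i : {i : Fin q.length // s ≤ q.blocksFun i}, xi R (subPart q i.1 i.2) := by
  rw [← xiBasis_apply, bgrLinear, Module.Basis.constr_basis]

theorem Y_eq (n s : ℕ) (q : Composition (n + s)) :
    ∑ i : {i : Fin q.length // s ≤ q.blocksFun i}, Xi R (subPart q i.1 i.2) =
      Y R n s q.blocksFun := by
  classical
  have h1 : ∀ i : {i : Fin q.length // s ≤ q.blocksFun i}, Xi R (subPart q i.1 i.2) =
      X R n (fun j => if j = i.1 then q.blocksFun j - s else q.blocksFun j) := by
    rintro ⟨i, hi⟩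
    obtain ⟨e, he⟩ := subPart_embedding q i hi
    rw [Xi_eq_X]
    symm
    refine X_restrict R n e _ (zero_off_range e.toEmbedding _ _ he ?_) _ he
    rw [(subPart q i hi).sum_blocksFun]
    have h2 : ∑ j, ((if j = i then q.blocksFun j - s else q.blocksFun j) +
        if j = i then s else 0) = n + s := by
      refine Eq.trans ?_ q.sum_blocksFun
      refine sum_congr rfl fun j _ => ?_
      split_ifs with hj
      · subst hj
        omega
      · rfl
    rw [sum_add_distrib, sum_ite_eq' univ i (fun _ => s), if_pos (mem_univ i)] at h2
    exact Nat.add_right_cancel h2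
  rw [sum_congr rfl fun i _ => h1 i]
  unfold X Y
  rw [sum_sigma']
  refine sum_bij (fun x _ => (x.2, x.1.1)) ?_ ?_ ?_ ?_
  · rintro ⟨⟨i, hi⟩, f⟩ hx
    simp only [mem_sigma, mem_filter, mem_univ, true_and] at hx ⊢
    funext j
    simp only [contentAdd, hx]
    by_cases hj : j = i
    · subst hj
      simp only [if_true]
      omega
    · simp [hj, Ne.symm hj]
  · rintro ⟨⟨i, hi⟩, f⟩ _ ⟨⟨j, hj⟩, g⟩ _ h
    simp only [Prod.mk.injEq] at h
    obtain ⟨rfl, rfl⟩ := h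
    rfl
  · rintro ⟨f, i⟩ hy
    simp only [mem_filter, mem_univ, true_and] at hy
    have hi : s ≤ q.blocksFun i := by
      have := congrFun hy i
      simp only [contentAdd, if_true] at this
      omega
    refine ⟨⟨⟨i, hi⟩, f⟩, ?_, rfl⟩
    simp only [mem_sigma, mem_filter, mem_univ, true_and]
    funext j
    have := congrFun hy j
    simp only [contentAdd] at this
    by_cases hj : j = i
    · subst hj
      simp only [if_true] at this ⊢
      omega
    · simp only [Ne.symm hj, if_false, add_zero] at this
      simp [hj, this]
  · intro x _
    rfl

theorem coe_bgrLinear (n s : ℕ) (x : descentAlgebra R (n + s)) :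
    (bgrLinear R n s x : MonoidAlgebra R (Equiv.Perm (Fin n))ᵐᵒᵖ) =
      (xiBasis R (n + s)).constr R (fun q => Y R n s q.blocksFun) x := by
  have h : (descentAlgebra R n).val.toLinearMap ∘ₗ bgrLinear R n s =
      (xiBasis R (n + s)).constr R (fun q => Y R n s q.blocksFun) := by
    refine (xiBasis R (n + s)).ext fun q => ?_
    rw [Module.Basis.constr_basis, ← Y_eq, LinearMap.comp_apply, xiBasis_apply, bgrLinear_xi,
      map_sum]
    rfl
  exact LinearMap.congr_fun h x

theorem bgrLinear_one (n s : ℕ) (hs : 0 < s) : bgrLinear R n s 1 = 1 := by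
  classical
  apply Subtype.ext
  rw [coe_bgrLinear]
  refine constr_one R _ _ fun q e h1 h2 => ?_
  rw [← Y_restrict R n s hs e (fun _ : Fin 1 => n + s) h2 _ h1]
  change _ = (1 : MonoidAlgebra R (Equiv.Perm (Fin n))ᵐᵒᵖ)
  rw [one_eq_X]
  unfold X Y
  refine sum_bij (fun p _ => p.1) ?_ ?_ ?_ ?_
  · intro p hp
    simp only [mem_filter, mem_univ, true_and] at hp ⊢
    funext x
    have := congrFun hp x
    rw [contentAdd, if_pos (Subsingleton.elim _ _)] at this
    omega
  · intro p _ p' _ h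
    exact Prod.ext h (Subsingleton.elim _ _)
  · intro f hf
    simp only [mem_filter, mem_univ, true_and] at hf
    refine ⟨(f, 0), ?_, rfl⟩
    simp only [mem_filter, mem_univ, true_and]
    funext x
    rw [contentAdd, if_pos (Subsingleton.elim _ _), hf]
  · intro p _
    rfl

theorem bgrLinear_mul (n s : ℕ) (hs : 0 < s) (x y : descentAlgebra R (n + s)) :
    bgrLinear R n s (x * y) = bgrLinear R n s x * bgrLinear R n s y := by
  apply Subtype.ext
  rw [MulMemClass.coe_mul, coe_bgrLinear, coe_bgrLinear, coe_bgrLinear]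
  exact constr_mul R _ (fun a => Y R n s a) (fun a => Y R n s a) (n + s) le_rfl
    (fun _ => rfl) (fun r q => Y_mul R n s r q _ le_rfl)
    (fun A _ e h1 h2 => Y_restrict R n s hs e A h2 _ h1) x y

/-- The Bergeron-Garsia-Reutenauer map, as a homomorphism of algebras. -/
noncomputable def bgr (n s : ℕ) (hs : 0 < s) : descentAlgebra R (n + s) →ₐ[R] descentAlgebra R n :=
  AlgHom.ofLinearMap (bgrLinear R n s) (bgrLinear_one R n s hs) (bgrLinear_mul R n s hs)

/-- The pullback of modules along the Bergeron-Garsia-Reutenauer map: on `V` an element `a` of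
the descent algebra of degree `n + s` acts as `Δ_s(a)`. -/
noncomputable def pullback (n s : ℕ) (hs : 0 < s) :
    ModuleCat (descentAlgebra R n) ⥤ ModuleCat (descentAlgebra R (n + s)) :=
  ModuleCat.restrictScalars (bgr R n s hs).toRingHom

end BGR

/-! ### Young characters and the simple modules -/

/-- `σ` belongs to the conjugacy class labelled by `μ`. -/
def HasType {n : ℕ} (σ : Equiv.Perm (Fin n)) (μ : n.Partition) : Prop :=
  σ.partition.parts = μ.parts

theorem exists_hasType {n : ℕ} (μ : n.Partition) : ∃ σ : Equiv.Perm (Fin n), HasType σ μ := by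
  have hsum : (μ.parts.filter fun i => 2 ≤ i).sum + (μ.parts.filter fun i => ¬ 2 ≤ i).sum = n := by
    rw [← Multiset.sum_add, Multiset.filter_add_not, μ.parts_sum]
  have hrep : (μ.parts.filter fun i => ¬ 2 ≤ i) =
      Multiset.replicate (Multiset.card (μ.parts.filter fun i => ¬ 2 ≤ i)) 1 := by
    refine Multiset.eq_replicate_card.2 fun b hb => ?_
    rw [Multiset.mem_filter] at hb
    have := μ.parts_pos hb.1
    omega
  have hsum1 : (μ.parts.filter fun i => ¬ 2 ≤ i).sum =
      Multiset.card (μ.parts.filter fun i => ¬ 2 ≤ i) := by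
    conv_lhs => rw [hrep]
    simp
  obtain ⟨σ, hσ⟩ := (Equiv.Perm.exists_with_cycleType_iff (Fin n)
    (m := μ.parts.filter fun i => 2 ≤ i)).2
    ⟨by rw [Fintype.card_fin]; omega, fun a ha => (Multiset.mem_filter.1 ha).2⟩
  refine ⟨σ, ?_⟩
  unfold HasType
  rw [Equiv.Perm.parts_partition, hσ, ← Equiv.Perm.sum_cycleType, hσ, Fintype.card_fin]
  have : n - (μ.parts.filter fun i => 2 ≤ i).sum =
    Multiset.card (μ.parts.filter fun i => ¬ 2 ≤ i) := by omega
  rw [this, ← hrep, Multiset.filter_add_not]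

/-- A permutation in the conjugacy class labelled by `μ`. -/
noncomputable def permOf {n : ℕ} (μ : n.Partition) : Equiv.Perm (Fin n) :=
  (exists_hasType μ).choose

theorem hasType_permOf {n : ℕ} (μ : n.Partition) : HasType (permOf μ) μ :=
  (exists_hasType μ).choose_spec

/-- The number of cosets of the Young subgroup of `q` that are fixed by `σ`. -/
noncomputable def fixedCosets {n : ℕ} (q : Composition n) (σ : Equiv.Perm (Fin n)) : ℕ :=
  Nat.card {c : Equiv.Perm (Fin n) ⧸ youngSubgroup q // σ • c = c}

/-- The value `φ^q(μ)` of the Young character of `q` on the conjugacy class labelled by `μ`. -/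
noncomputable def youngChar {n : ℕ} (q : Composition n) (μ : n.Partition) : ℕ :=
  fixedCosets q (permOf μ)

/-- The Young character does not depend on the choice of a permutation of type `μ`. -/
theorem youngChar_eq {n : ℕ} (q : Composition n) (μ : n.Partition) (σ : Equiv.Perm (Fin n))
    (hσ : HasType σ μ) : youngChar q μ = fixedCosets q σ := by
  have h : IsConj (permOf μ) σ := by
    rw [Equiv.Perm.partition_eq_of_isConj, Nat.Partition.ext_iff, hasType_permOf μ, hσ]
  obtain ⟨c, hc⟩ := isConj_iff.1 h
  refine Nat.card_congr ((MulAction.toPerm c).subtypeEquiv fun x => ?_)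
  rw [MulAction.toPerm_apply, ← hc, smul_smul, inv_mul_cancel_right, mul_smul]
  exact (smul_left_cancel_iff c).symm

section Characters

variable (R : Type*) [CommRing R]

theorem fixedCosets_eq {n : ℕ} (q : Composition n) (σ : Equiv.Perm (Fin n)) :
    (fixedCosets q σ : R) = Z R σ q.blocksFun := by
  classical
  let f : Equiv.Perm (Fin n) ⧸ youngSubgroup q → Fin n → Fin q.length :=
    Quotient.lift (fun w : Equiv.Perm (Fin n) => q.index ∘ w.symm) (by
      intro a b hab
      have hab' : a⁻¹ * b ∈ youngSubgroup q := QuotientGroup.leftRel_apply.1 hab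
      funext x
      have := hab' (b.symm x)
      simp only [Equiv.Perm.mul_apply, Equiv.apply_symm_apply] at this
      exact this)
  have hf : ∀ w : Equiv.Perm (Fin n), f (QuotientGroup.mk w) = q.index ∘ w.symm := fun w => rfl
  have hinj : Function.Injective f := by
    intro a b
    refine QuotientGroup.induction_on a fun a => QuotientGroup.induction_on b fun b => ?_
    intro h
    rw [hf, hf] at h
    refine QuotientGroup.eq.2 fun x => ?_
    have := congrFun h (b x)
    simpa using this
  have hcont : ∀ c, content (f c) = q.blocksFun := by
    intro c
    refine QuotientGroup.induction_on c fun w => ?_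
    rw [hf, content_comp_perm, content_index]
  have hsm : ∀ c, f (σ • c) = f c ∘ σ.symm := by
    intro c
    refine QuotientGroup.induction_on c fun w => rfl
  unfold Z fixedCosets
  rw [sum_const, nsmul_one, Nat.card_eq_fintype_card]
  congr 1
  rw [← card_univ]
  refine card_bij (fun c _ => ⟨f c.1, ?_⟩) ?_ ?_ ?_
  · have h1 := hsm c.1
    rw [c.2] at h1
    conv_lhs => rw [h1]
    funext x
    simp
  · intro c _
    simp only [mem_filter, mem_univ, true_and]
    exact hcont c.1
  · intro c _ d _ h
    exact Subtype.ext (hinj (congrArg Subtype.val h))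
  · rintro ⟨g, hg⟩ hgc
    simp only [mem_filter, mem_univ, true_and] at hgc
    obtain ⟨w, hw⟩ := exists_perm_of_content (f := g) (g := q.index) (by rw [content_index, hgc])
    have hfw : f (QuotientGroup.mk w⁻¹) = g := by
      rw [hf]
      exact hw
    refine ⟨⟨QuotientGroup.mk w⁻¹, hinj ?_⟩, mem_univ _, Subtype.ext hfw⟩
    rw [hsm, hfw]
    funext x
    have := congrFun hg (σ.symm x)
    simpa using this.symm

/-- The linear map with `Ξ^q ↦ φ^q(μ)`. -/
noncomputable def charLinear {n : ℕ} (μ : n.Partition) : descentAlgebra R n →ₗ[R] R :=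
  (xiBasis R n).constr R fun q => (youngChar q μ : R)

theorem charLinear_one {n : ℕ} (μ : n.Partition) : charLinear R μ 1 = 1 := by
  classical
  refine constr_one R _ _ fun q e h1 h2 => ?_
  rw [youngChar, fixedCosets_eq, ← Z_restrict R _ e (fun _ : Fin 1 => n) h2 _ h1]
  unfold Z
  rw [sum_eq_single_of_mem ⟨fun _ => 0, rfl⟩]
  · simp only [mem_filter, mem_univ, true_and]
    funext l
    have : l = 0 := Subsingleton.elim _ _
    subst this
    simp [content]
  · intro b _ hb
    exact absurd (Subtype.ext (Subsingleton.elim _ _)) hb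

theorem charLinear_mul {n : ℕ} (μ : n.Partition) (x y : descentAlgebra R n) :
    charLinear R μ (x * y) = charLinear R μ x * charLinear R μ y :=
  constr_mul R _ (fun a => Z R (permOf μ) a) (fun a => Z R (permOf μ) a) n le_rfl
    (fun q => fixedCosets_eq R q _) (fun r q => Z_mul R _ r q _ le_rfl)
    (fun A _ e h1 h2 => Z_restrict R _ e A h2 _ h1) x y

/-- The character `a ↦ θ(a)(μ)` of the descent algebra, with `Ξ^q ↦ φ^q(μ)`. -/
noncomputable def char {n : ℕ} (μ : n.Partition) : descentAlgebra R n →ₐ[R] R :=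
  AlgHom.ofLinearMap (charLinear R μ) (charLinear_one R μ) (charLinear_mul R μ)

theorem char_xi {n : ℕ} (μ : n.Partition) (q : Composition n) :
    char R μ (xi R q) = (youngChar q μ : R) := by
  rw [← xiBasis_apply]
  exact Module.Basis.constr_basis (xiBasis R n) R _ q

end Characters

/-- The module `M_μ` over the descent algebra: free of rank one over `R`, and `Ξ^q` acts as
multiplication by `φ^q(μ)`. -/
def M (R : Type*) [CommRing R] {n : ℕ} (_ : n.Partition) : Type _ := R

noncomputable instance (R : Type*) [CommRing R] {n : ℕ} (μ : n.Partition) :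
    AddCommGroup (M R μ) := inferInstanceAs (AddCommGroup R)

noncomputable instance (R : Type*) [CommRing R] {n : ℕ} (μ : n.Partition) :
    Module (descentAlgebra R n) (M R μ) := Module.compHom R (char R μ).toRingHom

/-! ### `p`-regular partitions and `p`-equivalence

Here `p` is the characteristic of a field, so a prime number or `0`; the characteristic `0`
stands for `p = ∞`. -/

/-- A partition is `p`-regular if no part occurs `p` times or more. -/
def IsRegular (p : ℕ) {n : ℕ} (μ : n.Partition) : Prop :=
  p = 0 ∨ ∀ i, μ.parts.count i ≤ p - 1

/-- The `p`-regular partitions of `n`. -/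
def RegularPartition (p n : ℕ) : Type := {μ : n.Partition // IsRegular p μ}

/-- `τ` is the `p'`-part of `σ`: `σ = τ u` with commuting `τ` and `u`, where `τ` has order prime
to `p` and `u` has order a power of `p`.  For `p = ∞` the `p'`-part of `σ` is `σ`. -/
def IsPPrimePart (p : ℕ) {G : Type*} [Group G] (σ τ : G) : Prop :=
  if p = 0 then τ = σ
  else ∃ u, σ = τ * u ∧ Commute τ u ∧ (orderOf τ).Coprime p ∧ ∃ k, orderOf u = p ^ k

/-- `p`-equivalence of partitions: the `p'`-parts of permutations in the conjugacy classes
labelled by `μ` and `ν` are conjugate. -/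
def PEquiv (p : ℕ) {n : ℕ} (μ ν : n.Partition) : Prop :=
  ∀ σ τ σ' τ' : Equiv.Perm (Fin n), HasType σ μ → HasType τ ν →
    IsPPrimePart p σ σ' → IsPPrimePart p τ τ' → IsConj σ' τ'

/-- The partition obtained from `μ` by appending a part `s`. -/
def appendPart {n : ℕ} (μ : n.Partition) (s : ℕ) (hs : 0 < s) : (n + s).Partition where
  parts := s ::ₘ μ.parts
  parts_pos := fun {i} hi => by
    rcases Multiset.mem_cons.1 hi with rfl | hi
    · exact hs
    · exact μ.parts_pos hi
  parts_sum := by rw [Multiset.sum_cons, μ.parts_sum, add_comm]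

end Descent

namespace Descent

open Finset

/-! ### Multisets of parts up to `p`-equivalence -/

/-! Everything about `p`-equivalence is read off from the weights of a partition: for each `m` prime
to `p`, the total size of the parts of the form `p ^ a * m`. A cycle of length `p ^ a * m` has as
`p'`-part a product of `p ^ a` cycles of length `m`, so the weights record the cycle type of the
`p'`-part, and two partitions are `p`-equivalent exactly if their weights agree (`pEquiv_iff`). The
proof never computes this cycle type; it counts the fixed points of all powers of a permutation,
which are sums of weights over the divisors of the exponent (`card_fixed_pow_pPrimePart`), and
inverts these sums.

Merging `p` equal parts `x` into one part `p * x` keeps the weights and ends in a `p`-regular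
partition (`exists_regular_weight`). In a `p`-regular partition the multiplicities of the parts `p ^
a * m` are the base-`p` digits of the weight divided by `m`, so the weights determine the partition
(`eq_of_weight_eq`). This gives existence and uniqueness of the regular partition. Appending a part
`s` adds the weights of `s`, whatever the partition is; cancelling them gives injectivity.

For the modules, cosets of a Young subgroup fixed by a permutation are words of given content
invariant under it. If an `s`-cycle on new letters is adjoined to the permutation, an invariant word
is constant on the new letters, and deleting these subtracts `s` from one entry of the content. This
is the rule defining the Bergeron-Garsia-Reutenauer map, so the pullback of a character belongs to
the partition with `s` appended (`char_comp_bgr`). Passing from there to the `p`-regular partition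
is harmless in characteristic `p`: a permutation and its `p'`-part fix the same number of cosets
modulo `p` (`card_fixed_modEq_pPrimePart`). -/

/-- The sum of the parts whose `p'`-part is `m`. -/
def weight (p : ℕ) (ν : Multiset ℕ) (m : ℕ) : ℕ :=
  (ν.filter fun x => ordCompl[p] x = m).sum

/-- The sum of the parts whose `p'`-part divides `d`. -/
def divWeight (p : ℕ) (ν : Multiset ℕ) (d : ℕ) : ℕ :=
  (ν.filter fun x => ordCompl[p] x ∣ d).sum

/-- By this convention `p = 0` serves as `p = ∞`: every number is its own `p'`-part. The case `p =
0` also describes ordinary cycle types when `p` is prime. -/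
theorem ordCompl_zero_left (x : ℕ) : ordCompl[0] x = x := by simp

/-- Each part is counted for one `m` only, its own `p'`-part. The case `d = 0` is excluded because
`Nat.divisors 0` is empty. -/
theorem divWeight_eq_sum (p : ℕ) (ν : Multiset ℕ) {d : ℕ} (hd : d ≠ 0) :
    divWeight p ν d = ∑ m ∈ d.divisors, weight p ν m := by
  unfold divWeight weight
  induction ν using Multiset.induction_on with
  | empty => simp
  | cons x ν ih =>
    simp only [Multiset.filter_cons, Multiset.sum_add, sum_add_distrib, ih]
    congr 1
    have h : ∀ m, (if ordCompl[p] x = m then ({x} : Multiset ℕ) else 0).sum =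
        if ordCompl[p] x = m then x else 0 := fun m => by split_ifs <;> simp
    simp only [h, sum_ite_eq, Nat.mem_divisors, hd, ne_eq, not_false_eq_true, and_true]
    split_ifs <;> simp

/-- Möbius inversion over divisors, in the form of a strong induction: the proper divisors of `m`
are already settled and cancel. -/
theorem weight_eq_of_divWeight_eq {p : ℕ} {ν ν' : Multiset ℕ}
    (h : ∀ d, d ≠ 0 → divWeight p ν d = divWeight p ν' d) (m : ℕ) (hm : m ≠ 0) :
    weight p ν m = weight p ν' m := by
  induction m using Nat.strong_induction_on with
  | _ m ih =>
    have h1 := h m hm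
    rw [divWeight_eq_sum p ν hm, divWeight_eq_sum p ν' hm, ← Nat.insert_self_properDivisors hm,
      sum_insert Nat.self_notMem_properDivisors, sum_insert Nat.self_notMem_properDivisors,
      sum_congr rfl fun k hk => ih k
        (Nat.mem_properDivisors.1 hk).2 (Nat.pos_of_mem_properDivisors hk).ne'] at h1
    exact Nat.add_right_cancel h1

theorem divWeight_eq_iff {p : ℕ} {ν ν' : Multiset ℕ} :
    (∀ d, d ≠ 0 → divWeight p ν d = divWeight p ν' d) ↔
      ∀ m, m ≠ 0 → weight p ν m = weight p ν' m := by
  refine ⟨weight_eq_of_divWeight_eq, fun h d hd => ?_⟩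
  rw [divWeight_eq_sum p ν hd, divWeight_eq_sum p ν' hd]
  exact sum_congr rfl fun m hm => h m (Nat.pos_of_mem_divisors hm).ne'

theorem weight_cons (p : ℕ) (x : ℕ) (ν : Multiset ℕ) (m : ℕ) :
    weight p (x ::ₘ ν) m = weight p {x} m + weight p ν m := by
  unfold weight
  rw [← Multiset.singleton_add, Multiset.filter_add, Multiset.sum_add]

theorem weight_add (p : ℕ) (ν ν' : Multiset ℕ) (m : ℕ) :
    weight p (ν + ν') m = weight p ν m + weight p ν' m := by
  unfold weight
  rw [Multiset.filter_add, Multiset.sum_add]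

theorem weight_replicate (p k x m : ℕ) :
    weight p (Multiset.replicate k x) m = if ordCompl[p] x = m then k * x else 0 := by
  unfold weight
  split_ifs with h
  · rw [Multiset.filter_eq_self.2 fun b hb => Multiset.eq_of_mem_replicate hb ▸ h]
    simp
  · rw [Multiset.filter_eq_nil.2 fun b hb => Multiset.eq_of_mem_replicate hb ▸ h]
    simp

/-- Replacing `p` equal parts `x` by a part `p * x` does not change the weights. -/
theorem weight_merge {p : ℕ} (hp : p.Prime) {x : ℕ} (m : ℕ) :
    weight p (Multiset.replicate p x) m = weight p {p * x} m := by
  have h : ordCompl[p] (p * x) = ordCompl[p] x := by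
    rw [Nat.ordCompl_mul, hp.factorization_self, pow_one, Nat.div_self hp.pos, one_mul]
  rw [weight_replicate, ← Multiset.replicate_one, weight_replicate, h, one_mul]

/-- As long as some part occurs at least `p` times, `p` copies of it are merged into one part. This
keeps the sum and the weights and lowers the number of parts by `p - 1 > 0`, so it stops. -/
theorem exists_regular_weight {p : ℕ} (hp : p = 0 ∨ p.Prime) (ν : Multiset ℕ) (hν : 0 ∉ ν) :
    ∃ ρ : Multiset ℕ, 0 ∉ ρ ∧ ρ.sum = ν.sum ∧ (p = 0 ∨ ∀ i, ρ.count i ≤ p - 1) ∧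
      ∀ m, weight p ρ m = weight p ν m := by
  rcases hp with rfl | hp
  · exact ⟨ν, hν, rfl, Or.inl rfl, fun _ => rfl⟩
  induction hk : Multiset.card ν using Nat.strong_induction_on generalizing ν with
  | _ k ih =>
    by_cases h : ∀ i, ν.count i ≤ p - 1
    · exact ⟨ν, hν, rfl, Or.inr h, fun _ => rfl⟩
    · push Not at h
      obtain ⟨x, hx⟩ := h
      obtain ⟨τ, rfl⟩ := Multiset.le_iff_exists_add.1
        (Multiset.le_count_iff_replicate_le.1 (show p ≤ ν.count x by omega))
      have hx0 : x ≠ 0 := by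
        rintro rfl
        exact hν (Multiset.count_pos.1 (by omega))
      have hp1 := hp.one_lt
      obtain ⟨ρ, h1, h2, h3, h4⟩ := ih (Multiset.card (p * x ::ₘ τ))
        (by rw [← hk, Multiset.card_cons, Multiset.card_add, Multiset.card_replicate]; omega)
        (p * x ::ₘ τ) (by
          rw [Multiset.mem_cons, not_or]
          exact ⟨(Nat.mul_pos hp.pos (Nat.pos_of_ne_zero hx0)).ne,
            fun h0 => hν (Multiset.mem_add.2 (Or.inr h0))⟩) rfl
      refine ⟨ρ, h1, ?_, h3, fun m => ?_⟩
      · rw [h2]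
        simp
      · rw [h4, weight_cons, weight_add, weight_merge hp]

/-- Reduction modulo `p` gives the lowest digit; after cancelling it and dividing by `p`, induction
gives the others. -/
theorem digits_unique {p : ℕ} (N : ℕ) (f g : ℕ → ℕ) (hf : ∀ a, f a < p) (hg : ∀ a, g a < p)
    (h : ∑ a ∈ range N, f a * p ^ a = ∑ a ∈ range N, g a * p ^ a) : ∀ a < N, f a = g a := by
  induction N generalizing f g with
  | zero => simp
  | succ N ih =>
    rw [sum_range_succ', sum_range_succ'] at h
    have e : ∀ f : ℕ → ℕ, ∑ a ∈ range N, f (a + 1) * p ^ (a + 1) =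
        p * ∑ a ∈ range N, f (a + 1) * p ^ a := fun f => by
      rw [mul_sum]
      exact sum_congr rfl fun a _ => by ring
    simp only [e, pow_zero, mul_one] at h
    have h0 : f 0 = g 0 := by
      have := congrArg (· % p) h
      simpa [Nat.mod_eq_of_lt (hf 0), Nat.mod_eq_of_lt (hg 0)] using this
    have hp : 0 < p := (Nat.zero_le _).trans_lt (hf 0)
    rw [h0] at h
    have h1 := Nat.eq_of_mul_eq_mul_left hp (Nat.add_right_cancel h)
    intro a ha
    rcases a with _ | a
    · exact h0
    · exact ih (fun a => f (a + 1)) (fun a => g (a + 1)) (fun a => hf _) (fun a => hg _) h1 a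
        (by omega)

/-- The positive numbers with `p'`-part `m` are the `p ^ a * m`. The multiplicities thus appear as
coefficients of powers of `p`, and they are genuine digits once they are less than `p`. The bound
`N` only makes the sum finite: `a < p ^ a ≤ x < N` for a part `x = p ^ a * m`. -/
theorem weight_eq_sum_count {p : ℕ} (hp : p.Prime) (ν : Multiset ℕ) (hν : 0 ∉ ν) {m : ℕ}
    (hm : ¬ p ∣ m) (N : ℕ) (hN : ∀ x ∈ ν, x < N) :
    weight p ν m = (∑ a ∈ range N, ν.count (p ^ a * m) * p ^ a) * m := by
  have hm0 : m ≠ 0 := fun h => hm (h ▸ dvd_zero p)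
  have hfac : ∀ a, ordCompl[p] (p ^ a * m) = m := fun a => by
    rw [Nat.ordCompl_mul, Nat.ordCompl_self_pow hp, one_mul, Nat.factorization_eq_zero_of_not_dvd hm,
      pow_zero, Nat.div_one]
  have hinj : Function.Injective fun a => p ^ a * m := fun a b hab =>
    Nat.pow_right_injective hp.two_le (Nat.eq_of_mul_eq_mul_right (Nat.pos_of_ne_zero hm0) hab)
  unfold weight
  rw [Finset.sum_multiset_count_of_subset _ ((range N).map ⟨_, hinj⟩), sum_map, sum_mul]
  · refine sum_congr rfl fun a _ => ?_
    simp only [Function.Embedding.coeFn_mk, smul_eq_mul]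
    rw [Multiset.count_filter_of_pos (p := fun x => ordCompl[p] x = m) (hfac a), mul_assoc]
  · intro x hx
    rw [Multiset.mem_toFinset, Multiset.mem_filter] at hx
    rw [mem_map]
    refine ⟨x.factorization p, mem_range.2 ?_, ?_⟩
    · refine lt_of_le_of_lt ?_ (hN x hx.1)
      exact (Nat.lt_pow_self hp.one_lt).le.trans
        (Nat.ordProj_le p (fun h => hν (h ▸ hx.1)))
    · simp only [Function.Embedding.coeFn_mk]
      rw [← hx.2]
      exact Nat.ordProj_mul_ordCompl_eq_self x p

/-- A `p`-regular multiset of parts is determined by its weights. -/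
theorem eq_of_weight_eq {p : ℕ} (hp : p = 0 ∨ p.Prime) {ν ρ : Multiset ℕ} (hν : 0 ∉ ν)
    (hρ : 0 ∉ ρ) (hν' : p = 0 ∨ ∀ i, ν.count i ≤ p - 1) (hρ' : p = 0 ∨ ∀ i, ρ.count i ≤ p - 1)
    (h : ∀ m, m ≠ 0 → weight p ν m = weight p ρ m) : ν = ρ := by
  ext x
  by_cases hx : x = 0
  · subst hx
    rw [Multiset.count_eq_zero_of_notMem hν, Multiset.count_eq_zero_of_notMem hρ]
  rcases hp with rfl | hp
  · have key : ∀ ν : Multiset ℕ, weight 0 ν x = ν.count x * x := fun ν => by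
      unfold weight
      simp only [ordCompl_zero_left]
      rw [Multiset.filter_eq', Multiset.sum_replicate, smul_eq_mul]
    have h1 := h x hx
    rw [key, key] at h1
    exact Nat.eq_of_mul_eq_mul_right (Nat.pos_of_ne_zero hx) h1
  · have hp1 := hp.one_lt
    have h2 : ∀ {ν : Multiset ℕ}, (p = 0 ∨ ∀ i, ν.count i ≤ p - 1) → ∀ i, ν.count i < p :=
      fun h i => by
        have := h.resolve_left hp.ne_zero i
        omega
    have hm0 : ordCompl[p] x ≠ 0 := (Nat.ordCompl_pos p hx).ne'
    have hmp : ¬ p ∣ ordCompl[p] x := Nat.not_dvd_ordCompl hp hx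
    -- Larger than every part of both multisets and than the exponent of `p` in `x`, so that one
    -- range of digits serves all purposes.
    set N := ν.sum + ρ.sum + x + 1 with hN
    have h1 := h _ hm0
    rw [weight_eq_sum_count hp ν hν hmp N fun y hy => by
        have := Multiset.single_le_sum (fun _ _ => Nat.zero_le _) y hy
        omega,
      weight_eq_sum_count hp ρ hρ hmp N fun y hy => by
        have := Multiset.single_le_sum (fun _ _ => Nat.zero_le _) y hy
        omega] at h1
    -- The multiplicity of `x` is the digit at the exponent of `p` in `x`, in the expansion for `m`
    -- the `p'`-part of `x`.
    have h3 := digits_unique N _ _ (fun a => h2 hν' _) (fun a => h2 hρ' _)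
      (Nat.eq_of_mul_eq_mul_right (Nat.pos_of_ne_zero hm0) h1) (x.factorization p) (by
        have := (Nat.lt_pow_self hp.one_lt).le.trans (Nat.ordProj_le p hx)
        omega)
    rwa [Nat.ordProj_mul_ordCompl_eq_self] at h3

/-! ### Fixed points of powers of permutations and of their `p'`-parts -/

section FixedPoints

variable {α : Type*} [Fintype α] [DecidableEq α]

/-- The `d`-th power of a cycle fixes all points of its support or none, according to whether the
length divides `d`. Disjoint cycles do not interfere, hence cycle induction. -/
theorem card_support_fixed_pow (σ : Equiv.Perm α) (d : ℕ) :
    #{x ∈ σ.support | (σ ^ d) x = x} = (σ.cycleType.filter (· ∣ d)).sum := by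
  induction σ using Equiv.Perm.cycle_induction_on with
  | base_one => simp
  | base_cycles σ hσ =>
    rw [hσ.cycleType, Multiset.filter_singleton]
    by_cases h : #σ.support ∣ d
    · have h1 : σ ^ d = 1 := orderOf_dvd_iff_pow_eq_one.1 (hσ.orderOf ▸ h)
      simp [h, h1]
    · rw [if_neg h, Multiset.empty_eq_zero, Multiset.sum_zero, card_eq_zero,
        filter_eq_empty_iff]
      intro x hx hfix
      refine h (hσ.orderOf ▸ orderOf_dvd_of_pow_eq_one ?_)
      exact (hσ.pow_eq_one_iff' (Equiv.Perm.mem_support.1 hx)).2 hfix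
  | induction_disjoint σ τ hd _ hσ hτ =>
    rw [hd.cycleType_mul, Multiset.filter_add, Multiset.sum_add, ← hσ, ← hτ, hd.support_mul,
      filter_union, card_union_of_disjoint]
    · congr 2
      · refine filter_congr fun x hx => ?_
        have h1 : τ x = x := (hd x).resolve_left (Equiv.Perm.mem_support.1 hx)
        rw [hd.commute.mul_pow, Equiv.Perm.mul_apply,
          Equiv.Perm.pow_apply_eq_self_of_apply_eq_self h1]
      · refine filter_congr fun x hx => ?_
        have h1 : σ x = x := (hd x).resolve_right (Equiv.Perm.mem_support.1 hx)
        rw [hd.commute.eq, hd.commute.symm.mul_pow, Equiv.Perm.mul_apply,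
          Equiv.Perm.pow_apply_eq_self_of_apply_eq_self h1]
    · exact disjoint_filter_filter hd.disjoint_support

/-- `cycleType` omits the cycles of length `1`; the fixed points of `σ` are counted separately, as
the parts `1` of the partition. -/
theorem card_fixed_pow (σ : Equiv.Perm α) (d : ℕ) :
    #{x | (σ ^ d) x = x} = divWeight 0 σ.partition.parts d := by
  unfold divWeight
  simp only [ordCompl_zero_left]
  rw [Equiv.Perm.parts_partition, Multiset.filter_add, Multiset.sum_add, ← card_support_fixed_pow,
    Multiset.filter_eq_self.2 fun b hb => (Multiset.eq_of_mem_replicate hb) ▸ one_dvd d,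
    Multiset.sum_replicate, smul_eq_mul, mul_one, ← card_compl,
    ← card_union_of_disjoint (disjoint_compl_right.mono_left (filter_subset _ _))]
  congr 1
  ext x
  simp only [mem_filter, mem_univ, true_and, mem_union, mem_compl, Equiv.Perm.mem_support,
    not_not]
  refine ⟨fun h => ?_, fun h => h.elim (fun h => h.2) fun h =>
    Equiv.Perm.pow_apply_eq_self_of_apply_eq_self h d⟩
  by_cases hx : σ x = x
  · exact Or.inr hx
  · exact Or.inl ⟨hx, h⟩

/-- By coprimality `g` is a power of `g ^ k`. With `H` a stabilizer: `g` fixes whatever `g ^ k`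
fixes. -/
theorem mem_of_pow_mem {G : Type*} [Group G] {H : Subgroup G} {g : G} {k : ℕ} (h : g ^ k ∈ H)
    (hk : (orderOf g).Coprime k) : g ∈ H := by
  obtain ⟨m, hm⟩ := exists_pow_eq_self_of_coprime hk.symm
  rw [← hm]
  exact pow_mem h m

/-- Raising `τ * u` to the power `p ^ k` kills `u`, and `τ` is a power of `τ ^ p ^ k`. With `H` a
stabilizer: the `p'`-part of a permutation fixes whatever the permutation fixes. -/
theorem mem_of_mul_mem {G : Type*} [Group G] {H : Subgroup G} {τ u : G} (hc : Commute τ u)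
    {p k : ℕ} (hτ : (orderOf τ).Coprime p) (hu : orderOf u = p ^ k) (h : τ * u ∈ H) : τ ∈ H := by
  refine mem_of_pow_mem (k := p ^ k) ?_ (hτ.pow_right k)
  have h1 := pow_mem h (p ^ k)
  rwa [hc.mul_pow, ← hu, pow_orderOf_eq_one, mul_one, hu] at h1

/-- Since `τ ^ d` has order prime to `p`, it has the same fixed points as its power with exponent `p
^ N`, which for large `N` is the power `d * p ^ N` of `σ`. A part divides `d * p ^ N` for large `N`
exactly if its `p'`-part divides `d`. -/
theorem card_fixed_pow_pPrimePart {p : ℕ} (hp : p = 0 ∨ p.Prime) {σ τ : Equiv.Perm α}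
    (h : IsPPrimePart p σ τ) (d : ℕ) :
    #{x | (τ ^ d) x = x} = divWeight p σ.partition.parts d := by
  rcases hp with rfl | hp
  · unfold IsPPrimePart at h
    rw [if_pos rfl] at h
    rw [h, card_fixed_pow]
  unfold IsPPrimePart at h
  rw [if_neg hp.ne_zero] at h
  obtain ⟨u, rfl, hc, hτ, k, hu⟩ := h
  set σ := τ * u with hσ
  -- The summand `k` makes the power of `u` trivial; the summand `Fintype.card α` bounds the
  -- exponent of `p` in every part.
  set N := k + Fintype.card α with hN
  have h1 : σ ^ (d * p ^ N) = (τ ^ d) ^ p ^ N := by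
    have h2 : u ^ (d * p ^ N) = 1 := by
      rw [← orderOf_dvd_iff_pow_eq_one, hu]
      exact (pow_dvd_pow p (Nat.le_add_right _ _)).mul_left d
    rw [hσ, hc.mul_pow, h2, mul_one, pow_mul]
  have h3 : ∀ x, (τ ^ d) x = x ↔ (σ ^ (d * p ^ N)) x = x := by
    intro x
    rw [h1]
    refine ⟨fun h => Equiv.Perm.pow_apply_eq_self_of_apply_eq_self h _, fun h => ?_⟩
    exact mem_of_pow_mem (H := MulAction.stabilizer (Equiv.Perm α) x) (g := τ ^ d) h
      ((hτ.coprime_dvd_left (orderOf_pow_dvd d)).pow_right N)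
  simp only [h3]
  rw [card_fixed_pow]
  unfold divWeight
  congr 1
  refine Multiset.filter_congr fun x hx => ?_
  have hx0 := σ.partition.parts_pos hx
  have hxle : x ≤ Fintype.card α := by
    have := Multiset.single_le_sum (fun _ _ => Nat.zero_le _) x hx
    rwa [σ.partition.parts_sum] at this
  rw [ordCompl_zero_left]
  constructor
  · intro h
    refine Nat.Coprime.dvd_of_dvd_mul_right ?_ ((Nat.ordCompl_dvd x p).trans h)
    exact ((Nat.coprime_ordCompl hp hx0.ne').symm).pow_right N
  · intro h
    rw [← Nat.ordProj_mul_ordCompl_eq_self x p, mul_comm]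
    refine mul_dvd_mul h (pow_dvd_pow p ?_)
    exact (Nat.lt_pow_self hp.one_lt).le.trans
      ((Nat.ordProj_le p hx0.ne').trans (hxle.trans (Nat.le_add_left _ _)))

/-- The fixed points of the powers determine the cycle type: Möbius inversion together with the case
`p = 0` of `eq_of_weight_eq`. -/
theorem parts_eq_of_card_fixed_pow {σ : Equiv.Perm α} {ν : Multiset ℕ} (hν : 0 ∉ ν)
    (h : ∀ d, d ≠ 0 → #{x | (σ ^ d) x = x} = divWeight 0 ν d) : σ.partition.parts = ν :=
  eq_of_weight_eq (Or.inl rfl) (fun h => (σ.partition.parts_pos h).ne rfl) hν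
    (Or.inl rfl) (Or.inl rfl) (weight_eq_of_divWeight_eq fun d hd => by
      rw [← card_fixed_pow, h d hd])

theorem isConj_iff_card_fixed_pow {σ τ : Equiv.Perm α} :
    IsConj σ τ ↔ ∀ d, d ≠ 0 → #{x | (σ ^ d) x = x} = #{x | (τ ^ d) x = x} := by
  rw [Equiv.Perm.partition_eq_of_isConj, Nat.Partition.ext_iff]
  constructor
  · intro h d _
    rw [card_fixed_pow, card_fixed_pow, h]
  · intro h
    refine parts_eq_of_card_fixed_pow (fun h => (τ.partition.parts_pos h).ne rfl) fun d hd => ?_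
    rw [h d hd, card_fixed_pow]

/-- `PEquiv` quantifies over all `p'`-parts, so it says something only because they exist. -/
theorem exists_pPrimePart {G : Type*} [Group G] [Finite G] {p : ℕ} (hp : p = 0 ∨ p.Prime)
    (σ : G) : ∃ τ, IsPPrimePart p σ τ := by
  unfold IsPPrimePart
  rcases hp with rfl | hp
  · exact ⟨σ, by rw [if_pos rfl]⟩
  simp only [if_neg hp.ne_zero]
  have h0 : orderOf σ ≠ 0 := (orderOf_pos σ).ne'
  set q := ordProj[p] (orderOf σ) with hq
  set m := ordCompl[p] (orderOf σ) with hm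
  have hqm : q * m = orderOf σ := Nat.ordProj_mul_ordCompl_eq_self _ _
  have hcop : Nat.Coprime q m := (Nat.coprime_ordCompl hp h0).pow_left _
  have hb : (q : ℤ) * q.gcdA m + m * q.gcdB m = 1 := by
    rw [← Nat.gcd_eq_gcd_ab, hcop.gcd_eq_one, Nat.cast_one]
  have hσ : σ ^ ((q : ℤ) * m) = 1 := by
    rw [← Nat.cast_mul, hqm, zpow_natCast, pow_orderOf_eq_one]
  -- The order of `σ` is `q * m` with `q` a power of `p` and `m` prime to `p`. The two exponents are
  -- the terms of the Bézout identity, so the factors multiply to `σ` and have orders dividing `m`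
  -- and `q`.
  refine ⟨σ ^ ((q : ℤ) * q.gcdA m), σ ^ ((m : ℤ) * q.gcdB m), ?_, ?_, ?_, ?_⟩
  · rw [← zpow_add, hb, zpow_one]
  · exact (Commute.refl σ).zpow_zpow _ _
  · refine Nat.Coprime.coprime_dvd_left (orderOf_dvd_of_pow_eq_one (n := m) ?_)
      (Nat.coprime_ordCompl hp h0).symm
    rw [← zpow_natCast, ← zpow_mul, mul_right_comm, zpow_mul, hσ, one_zpow]
  · refine (Nat.dvd_prime_pow hp).1 (orderOf_dvd_of_pow_eq_one (n := q) ?_) |>.imp fun _ h => h.2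
    rw [← zpow_natCast, ← zpow_mul, mul_right_comm, mul_comm (m : ℤ), zpow_mul, hσ, one_zpow]

end FixedPoints

/-! ### `p`-equivalence through weights -/

theorem Partition.zero_notMem {n : ℕ} (μ : n.Partition) : 0 ∉ μ.parts :=
  fun h => (μ.parts_pos h).ne rfl

/-- Conjugacy of the `p'`-parts is equality of the numbers of fixed points of their powers, and
these depend only on the weights of the original partitions. -/
theorem pEquiv_iff {p : ℕ} (hp : p = 0 ∨ p.Prime) {n : ℕ} (μ ν : n.Partition) :
    PEquiv p μ ν ↔ ∀ m, m ≠ 0 → weight p μ.parts m = weight p ν.parts m := by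
  rw [← divWeight_eq_iff]
  constructor
  · intro h d hd
    obtain ⟨σ', hσ'⟩ := exists_pPrimePart hp (permOf μ)
    obtain ⟨τ', hτ'⟩ := exists_pPrimePart hp (permOf ν)
    have h1 := isConj_iff_card_fixed_pow.1
      (h _ _ _ _ (hasType_permOf μ) (hasType_permOf ν) hσ' hτ') d hd
    rwa [card_fixed_pow_pPrimePart hp hσ' d, card_fixed_pow_pPrimePart hp hτ' d,
      hasType_permOf μ, hasType_permOf ν] at h1
  · intro h σ τ σ' τ' hσ hτ hσ' hτ'
    rw [isConj_iff_card_fixed_pow]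
    intro d hd
    rw [card_fixed_pow_pPrimePart hp hσ' d, card_fixed_pow_pPrimePart hp hτ' d, hσ, hτ, h d hd]

theorem exists_regular_pEquiv {p : ℕ} (hp : p = 0 ∨ p.Prime) {n : ℕ} (μ : n.Partition) :
    ∃ ρ : RegularPartition p n, PEquiv p ρ.1 μ := by
  obtain ⟨ρ, h0, hs, hr, hw⟩ := exists_regular_weight hp μ.parts (Partition.zero_notMem μ)
  refine ⟨⟨⟨ρ, fun {i} hi => Nat.pos_of_ne_zero fun h => h0 (h ▸ hi),
    hs.trans μ.parts_sum⟩, hr⟩, ?_⟩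
  exact (pEquiv_iff hp _ _).2 fun m _ => hw m

theorem RegularPartition.eq_of_weight_eq {p : ℕ} (hp : p = 0 ∨ p.Prime) {n : ℕ}
    {μ ν : RegularPartition p n}
    (h : ∀ m, m ≠ 0 → weight p μ.1.parts m = weight p ν.1.parts m) : μ = ν :=
  Subtype.ext (Nat.Partition.ext (Descent.eq_of_weight_eq hp (Partition.zero_notMem _)
    (Partition.zero_notMem _) μ.2 ν.2 h))

/-! ### Appending a cycle -/

theorem finRotate_pow_val {s : ℕ} (d : ℕ) (i : Fin s) :
    ((finRotate s ^ d) i : ℕ) = (i + d) % s := by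
  induction d with
  | zero => simp [Nat.mod_eq_of_lt i.2]
  | succ d ih =>
    obtain ⟨k, rfl⟩ : ∃ k, s = k + 1 := ⟨s - 1, by have := i.2; omega⟩
    rw [pow_succ', Equiv.Perm.mul_apply, finRotate_apply, Fin.val_add, ih, Fin.val_one']
    rw [← Nat.add_mod, add_assoc]

theorem finRotate_pow_apply_eq_self {s : ℕ} (d : ℕ) (i : Fin s) :
    (finRotate s ^ d) i = i ↔ s ∣ d := by
  rw [Fin.ext_iff, finRotate_pow_val]
  conv_lhs => rw [← Nat.mod_eq_of_lt i.2]
  rw [Nat.mod_add_mod]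
  exact eq_comm.trans Nat.left_modEq_add_iff

/-- The permutation of `n + s` letters that acts as `σ` on the first `n` letters, and as a cycle
of length `s` on the others. -/
def appendCycle {n : ℕ} (σ : Equiv.Perm (Fin n)) (s : ℕ) : Equiv.Perm (Fin (n + s)) :=
  finSumFinEquiv.permCongr (Equiv.Perm.sumCongr σ (finRotate s))

theorem appendCycle_castAdd {n : ℕ} (σ : Equiv.Perm (Fin n)) (s : ℕ) (i : Fin n) :
    appendCycle σ s (Fin.castAdd s i) = Fin.castAdd s (σ i) := by
  simp [appendCycle, Equiv.permCongr_apply]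

theorem appendCycle_natAdd {n : ℕ} (σ : Equiv.Perm (Fin n)) (s : ℕ) (i : Fin s) :
    appendCycle σ s (Fin.natAdd n i) = Fin.natAdd n (finRotate s i) := by
  simp [appendCycle, Equiv.permCongr_apply]

theorem appendCycle_pow_castAdd {n : ℕ} (σ : Equiv.Perm (Fin n)) (s d : ℕ) (i : Fin n) :
    (appendCycle σ s ^ d) (Fin.castAdd s i) = Fin.castAdd s ((σ ^ d) i) := by
  induction d with
  | zero => rfl
  | succ d ih => simp only [pow_succ', Equiv.Perm.mul_apply, ih, appendCycle_castAdd]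

theorem appendCycle_pow_natAdd {n : ℕ} (σ : Equiv.Perm (Fin n)) (s d : ℕ) (i : Fin s) :
    (appendCycle σ s ^ d) (Fin.natAdd n i) = Fin.natAdd n ((finRotate s ^ d) i) := by
  induction d with
  | zero => rfl
  | succ d ih => simp only [pow_succ', Equiv.Perm.mul_apply, ih, appendCycle_natAdd]

/-- The cycle type is recognized by fixed points of powers: the `d`-th power fixes those of `σ ^ d`,
and all or none of the `s` new letters according to whether `s` divides `d`. -/
theorem hasType_appendCycle {n : ℕ} {σ : Equiv.Perm (Fin n)} {μ : n.Partition}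
    (hσ : HasType σ μ) (s : ℕ) (hs : 0 < s) : HasType (appendCycle σ s) (appendPart μ s hs) := by
  refine parts_eq_of_card_fixed_pow (Partition.zero_notMem _) fun d _ => ?_
  have h : divWeight 0 (appendPart μ s hs).parts d =
      #{x | (σ ^ d) x = x} + if s ∣ d then s else 0 := by
    rw [card_fixed_pow, hσ]
    unfold divWeight
    simp only [appendPart, ordCompl_zero_left, Multiset.filter_cons, Multiset.sum_add]
    split_ifs <;> simp [add_comm]
  rw [h, card_filter, card_filter, Fin.sum_univ_add]
  simp only [appendCycle_pow_castAdd, appendCycle_pow_natAdd, (Fin.castAdd_injective n s).eq_iff,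
    (Fin.natAdd_injective s n).eq_iff, finRotate_pow_apply_eq_self]
  simp

/-! ### Young characters of the appended partition -/

theorem apply_pow_of_comp_eq {α L : Type*} {σ : Equiv.Perm α} {f : α → L} (h : f ∘ σ = f)
    (d : ℕ) (x : α) : f ((σ ^ d) x) = f x := by
  induction d with
  | zero => rfl
  | succ d ih =>
    rw [pow_succ', Equiv.Perm.mul_apply]
    exact (congrFun h _).trans ih

theorem content_append {n s : ℕ} {L : Type*} [DecidableEq L] (f : Fin n → L) (i j : L) :
    content (Fin.append f fun _ : Fin s => i) j = content f j + if i = j then s else 0 := by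
  unfold content
  rw [card_filter, card_filter, Fin.sum_univ_add]
  simp only [Fin.append_left, Fin.append_right]
  simp

theorem append_comp_appendCycle {n s : ℕ} {L : Type*} {σ : Equiv.Perm (Fin n)} {f : Fin n → L}
    (hf : f ∘ σ = f) (i : L) : (Fin.append f fun _ : Fin s => i) ∘ appendCycle σ s =
      Fin.append f fun _ => i := by
  funext x
  refine Fin.addCases (fun x => ?_) (fun x => ?_) x
  · rw [Function.comp_apply, appendCycle_castAdd, Fin.append_left, Fin.append_left]
    exact congrFun hf x
  · rw [Function.comp_apply, appendCycle_natAdd, Fin.append_right, Fin.append_right]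

theorem exists_append_of_comp_appendCycle {n s : ℕ} (hs : 0 < s) {L : Type*}
    {σ : Equiv.Perm (Fin n)} {g : Fin (n + s) → L} (hg : g ∘ appendCycle σ s = g) :
    ∃ (f : Fin n → L) (i : L), f ∘ σ = f ∧ (Fin.append f fun _ => i) = g := by
  refine ⟨fun x => g (Fin.castAdd s x), g (Fin.natAdd n ⟨0, hs⟩), ?_, ?_⟩
  · funext x
    simpa [appendCycle_castAdd] using congrFun hg (Fin.castAdd s x)
  · funext x
    refine Fin.addCases (fun x => ?_) (fun x => ?_) x
    · rw [Fin.append_left]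
    -- The `x`-th power of the cycle carries the first new letter to the `x`-th one, so `g` takes
    -- the same value at both.
    · rw [Fin.append_right, ← apply_pow_of_comp_eq hg x, appendCycle_pow_natAdd]
      congr 2
      rw [Fin.ext_iff, finRotate_pow_val, zero_add, Nat.mod_eq_of_lt x.2]

/-- An invariant word is a `σ`-invariant word followed by `s` copies of one letter `i`; without
these copies the content at `i` is smaller by `s`. This is the counterpart of `Y_eq` on the side of
the characters. -/
theorem Z_appendCycle (R : Type*) [CommRing R] {n : ℕ} (σ : Equiv.Perm (Fin n)) {s : ℕ}
    (hs : 0 < s) {L : Type*} [LinearOrder L] [Fintype L] (a : L → ℕ) :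
    Z R (appendCycle σ s) a = ∑ i : {i // s ≤ a i},
      Z R σ (fun j => if j = i.1 then a j - s else a j) := by
  classical
  unfold Z
  rw [sum_sigma']
  symm
  refine sum_bij (fun x _ => ⟨Fin.append x.2.1 fun _ => x.1.1,
    append_comp_appendCycle x.2.2 x.1.1⟩) ?_ ?_ ?_ ?_
  · rintro ⟨⟨i, hi⟩, f⟩ hx
    simp only [mem_sigma, mem_filter, mem_univ, true_and] at hx ⊢
    funext j
    rw [content_append, hx]
    by_cases hj : j = i
    · subst hj
      simp only [if_true]
      omega
    · simp [hj, Ne.symm hj]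
  · rintro ⟨⟨i, hi⟩, ⟨f, hf⟩⟩ _ ⟨⟨j, hj⟩, ⟨g, hg⟩⟩ _ h
    have h1 := congrArg Subtype.val h
    obtain rfl : f = g := funext fun x => by simpa using congrFun h1 (Fin.castAdd s x)
    -- The repeated letter is read off at the first new position, which exists because `s` is
    -- positive.
    obtain rfl : i = j := by
      simpa only [Fin.append_right] using congrFun h1 (Fin.natAdd n ⟨0, hs⟩)
    rfl
  · rintro ⟨g, hg⟩ hy
    obtain ⟨f, i, hf, rfl⟩ := exists_append_of_comp_appendCycle hs hg
    simp only [mem_filter, mem_univ, true_and] at hy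
    have hy' : ∀ j, content f j + (if i = j then s else 0) = a j := fun j => by
      rw [← content_append, hy]
    have hi : s ≤ a i := by
      have := hy' i
      rw [if_pos rfl] at this
      omega
    refine ⟨⟨⟨i, hi⟩, ⟨f, hf⟩⟩, ?_, rfl⟩
    simp only [mem_sigma, mem_filter, mem_univ, true_and]
    funext j
    have := hy' j
    by_cases hj : j = i
    · subst hj
      simp only [if_true] at this ⊢
      omega
    · simp only [Ne.symm hj, if_false, add_zero] at this
      simp [hj, this]
  · intro x _
    rfl

theorem sum_sub_part {n s : ℕ} (q : Composition (n + s)) (i : Fin q.length)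
    (hi : s ≤ q.blocksFun i) :
    ∑ j, (if j = i then q.blocksFun j - s else q.blocksFun j) = n := by
  have h : ∑ j, ((if j = i then q.blocksFun j - s else q.blocksFun j) +
      if j = i then s else 0) = n + s := by
    refine Eq.trans ?_ q.sum_blocksFun
    refine sum_congr rfl fun j _ => ?_
    split_ifs with hj
    · subst hj
      omega
    · rfl
  rw [sum_add_distrib, sum_ite_eq' univ i (fun _ => s), if_pos (mem_univ i)] at h
  exact Nat.add_right_cancel h

theorem youngChar_appendPart (R : Type*) [CommRing R] {n s : ℕ} (hs : 0 < s) (μ : n.Partition)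
    (q : Composition (n + s)) : (youngChar q (appendPart μ s hs) : R) =
      ∑ i : {i : Fin q.length // s ≤ q.blocksFun i}, (youngChar (subPart q i.1 i.2) μ : R) := by
  -- The chosen permutation of the appended type is traded for the one with an explicit last cycle.
  rw [youngChar_eq q _ _ (hasType_appendCycle (hasType_permOf μ) s hs), fixedCosets_eq,
    Z_appendCycle R _ hs]
  refine sum_congr rfl fun i _ => ?_
  obtain ⟨e, he⟩ := subPart_embedding q i.1 i.2
  rw [youngChar, fixedCosets_eq]
  -- `subPart` deletes an entry that has become zero, and no word uses such a letter. The entries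
  -- kept already have sum `n`, so nothing nonzero is lost.
  refine Z_restrict R _ e _ (zero_off_range e.toEmbedding _ _ he ?_) _ he
  rw [(subPart q i.1 i.2).sum_blocksFun, sum_sub_part q i.1 i.2]

/-- Compared on the basis `Ξ^q`, this is `youngChar_appendPart`. It holds over any commutative ring;
the characteristic enters only when the appended partition is replaced by a `p`-regular one. -/
theorem char_comp_bgr (R : Type*) [CommRing R] {n s : ℕ} (hs : 0 < s) (μ : n.Partition)
    (x : descentAlgebra R (n + s)) :
    char R μ (bgr R n s hs x) = char R (appendPart μ s hs) x := by
  have h : (char R μ).toLinearMap ∘ₗ (bgr R n s hs).toLinearMap =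
      (char R (appendPart μ s hs)).toLinearMap := by
    refine (xiBasis R (n + s)).ext fun q => ?_
    rw [xiBasis_apply]
    change char R μ (bgrLinear R n s (xi R q)) = char R (appendPart μ s hs) (xi R q)
    rw [bgrLinear_xi, map_sum, char_xi, youngChar_appendPart]
    exact sum_congr rfl fun i _ => char_xi R _ _
  exact LinearMap.congr_fun h x

/-! ### Young characters modulo `p` -/

/-- As `u` commutes with `τ`, it acts on the fixed points of `τ`, and its orbits there have
`p`-power size, so modulo `p` only its fixed points count. A point fixed by `τ * u` is fixed by `τ`,
by coprimality, and then by `u`; hence these are the fixed points of `τ * u`. -/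
theorem card_fixed_modEq_pPrimePart {p : ℕ} [Fact p.Prime] {G X : Type*} [Group G]
    [MulAction G X] [Finite X] {τ u : G} (hc : Commute τ u) (hτ : (orderOf τ).Coprime p)
    {k : ℕ} (hu : orderOf u = p ^ k) :
    Nat.card {x : X // τ • x = x} ≡ Nat.card {x : X // (τ * u) • x = x} [MOD p] := by
  classical
  have := Fintype.ofFinite X
  let f : Function.End {x : X // τ • x = x} := fun x => ⟨u • x.1, by
    rw [smul_smul, hc.eq, mul_smul, x.2]⟩
  have hpow : ∀ m x, ((f ^ m) x).1 = u ^ m • x.1 := by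
    intro m
    induction m with
    | zero => intro x; rw [pow_zero, pow_zero, one_smul]; rfl
    | succ m ih =>
      intro x
      rw [pow_succ', pow_succ', mul_smul, ← ih]
      rfl
  have hf : f ^ p ^ k = 1 := by
    funext x
    apply Subtype.ext
    rw [hpow, ← hu, pow_orderOf_eq_one, one_smul]
    rfl
  have h := Equiv.Perm.card_fixedPoints_modEq hf
  rw [← Nat.card_eq_fintype_card, ← Nat.card_eq_fintype_card] at h
  have h2 : ∀ x : {x : X // (τ * u) • x = x}, τ • x.1 = x.1 := fun x =>
    mem_of_mul_mem (H := MulAction.stabilizer G x.1) hc hτ hu x.2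
  have h3 : ∀ x : {x : X // (τ * u) • x = x}, u • x.1 = x.1 := fun x => by
    have h3 : (u * τ) • x.1 = x.1 := (congrArg (· • x.1) hc.eq.symm).trans x.2
    rwa [mul_smul, h2] at h3
  have h4 : ∀ x : Function.fixedPoints f, (τ * u) • x.1.1 = x.1.1 := fun x => by
    have h4 : u • x.1.1 = x.1.1 := congrArg Subtype.val x.2
    rw [mul_smul, h4, x.1.2]
  rw [Nat.card_congr (α := {x : X // (τ * u) • x = x}) (β := Function.fixedPoints f)
    { toFun := fun x => ⟨⟨x.1, h2 x⟩, Subtype.ext (h3 x)⟩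
      invFun := fun x => ⟨x.1.1, h4 x⟩
      left_inv := fun _ => rfl
      right_inv := fun _ => rfl }]
  exact h

theorem fixedCosets_pPrimePart (F : Type*) [CommRing F] {p : ℕ} [CharP F p]
    (hp : p = 0 ∨ p.Prime) {n : ℕ} (q : Composition n) {σ τ : Equiv.Perm (Fin n)}
    (h : IsPPrimePart p σ τ) : (fixedCosets q σ : F) = fixedCosets q τ := by
  unfold IsPPrimePart at h
  rcases hp with rfl | hp
  · rw [if_pos rfl] at h
    rw [h]
  rw [if_neg hp.ne_zero] at h
  obtain ⟨u, rfl, hc, hτ, k, hu⟩ := h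
  have := Fact.mk hp
  refine (CharP.natCast_eq_natCast F p).2 ?_
  exact (card_fixed_modEq_pPrimePart hc hτ hu).symm

theorem fixedCosets_eq_of_isConj {n : ℕ} (q : Composition n) {σ τ : Equiv.Perm (Fin n)}
    (h : IsConj σ τ) : fixedCosets q σ = fixedCosets q τ := by
  -- `σ.partition` is a partition of `Fintype.card (Fin n)`, so its parts are repackaged as a
  -- partition of `n`.
  have hσ : HasType σ ⟨σ.partition.parts, σ.partition.parts_pos, by
    rw [σ.partition.parts_sum, Fintype.card_fin]⟩ := rfl
  rw [← youngChar_eq q _ σ hσ]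
  refine youngChar_eq q _ τ ?_
  exact congrArg Nat.Partition.parts (Equiv.Perm.partition_eq_of_isConj.1 h).symm

/-- Each side is replaced by the value at a `p'`-part, unchanged in characteristic `p`, and these
`p'`-parts are conjugate. -/
theorem youngChar_eq_of_pEquiv (F : Type*) [CommRing F] {p : ℕ} [CharP F p]
    (hp : p = 0 ∨ p.Prime) {n : ℕ} {μ ν : n.Partition} (h : PEquiv p μ ν) (q : Composition n) :
    (youngChar q μ : F) = youngChar q ν := by
  obtain ⟨σ, hσ⟩ := exists_pPrimePart hp (permOf μ)
  obtain ⟨τ, hτ⟩ := exists_pPrimePart hp (permOf ν)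
  unfold youngChar
  rw [fixedCosets_pPrimePart F hp q hσ, fixedCosets_pPrimePart F hp q hτ,
    fixedCosets_eq_of_isConj q (h _ _ _ _ (hasType_permOf μ) (hasType_permOf ν) hσ hτ)]

theorem char_eq_of_pEquiv (F : Type*) [CommRing F] {p : ℕ} [CharP F p]
    (hp : p = 0 ∨ p.Prime) {n : ℕ} {μ ν : n.Partition} (h : PEquiv p μ ν) :
    char F μ = char F ν := by
  refine AlgHom.toLinearMap_injective ((xiBasis F n).ext fun q => ?_)
  rw [xiBasis_apply]
  exact (char_xi F μ q).trans ((youngChar_eq_of_pEquiv F hp h q).trans (char_xi F ν q).symm)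

/-! ### The modules `M_μ` -/

theorem smul_M (R : Type*) [CommRing R] {n : ℕ} (μ : n.Partition) (a : descentAlgebra R n)
    (x : M R μ) : a • x = (char R μ a * (show R from x) : R) := rfl

/-- The scalars of `F` lie in the descent algebra and act by multiplication, so every nonzero vector
generates. -/
theorem isSimpleModule_M (F : Type*) [Field F] {n : ℕ} (μ : n.Partition) :
    IsSimpleModule (descentAlgebra F n) (M F μ) := by
  rw [isSimpleModule_iff_toSpanSingleton_surjective]
  refine ⟨inferInstanceAs (Nontrivial F), fun x hx y => ?_⟩
  have hx' : (show F from x) ≠ 0 := hx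
  refine ⟨algebraMap F _ ((show F from y) * (show F from x)⁻¹), ?_⟩
  rw [LinearMap.toSpanSingleton_apply, smul_M, AlgHom.commutes]
  exact inv_mul_cancel_right₀ hx' _

theorem nonempty_pullback_iso (R : Type*) [CommRing R] {n s : ℕ} (hs : 0 < s) (μ : n.Partition)
    (ν : (n + s).Partition) (h : char R ν = char R (appendPart μ s hs)) :
    Nonempty ((pullback R n s hs).obj (ModuleCat.of (descentAlgebra R n) (M R μ)) ≅
      ModuleCat.of (descentAlgebra R (n + s)) (M R ν)) := by
  let X := (ModuleCat.restrictScalars (bgr R n s hs).toRingHom).obj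
    (ModuleCat.of (descentAlgebra R n) (M R μ))
  -- Both modules are `R` with an action through a character, so the identity is the isomorphism.
  -- The instances on `X` are named to select the action restricted along the
  -- Bergeron-Garsia-Reutenauer map.
  refine ⟨@LinearEquiv.toModuleIso _ _ X (M R ν) X.isAddCommGroup _ X.isModule _
    { toFun := fun x => (show R from x)
      invFun := fun x => (show R from x)
      map_add' := fun _ _ => rfl
      map_smul' := fun a x => ?_
      left_inv := fun _ => rfl
      right_inv := fun _ => rfl }⟩
  change char R μ (bgr R n s hs a) * (show R from x) = char R ν a * (show R from x)
  rw [char_comp_bgr, h]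

end Descent

theorem theorem4p5 (F : Type*) [Field F] (p : ℕ) [CharP F p] (s : ℕ) (hs : 0 < s) :
    ∃ sharp : ∀ n : ℕ, Descent.RegularPartition p n → Descent.RegularPartition p (n + s),
      (∀ (n : ℕ) (μ : Descent.RegularPartition p n) (ν : Descent.RegularPartition p (n + s)),
        Descent.PEquiv p ν.1 (Descent.appendPart μ.1 s hs) ↔ ν = sharp n μ) ∧
      (∀ (n : ℕ) (μ : Descent.RegularPartition p n),
        IsSimpleModule (Descent.descentAlgebra F n) (Descent.M F μ.1) ∧
        IsSimpleModule (Descent.descentAlgebra F (n + s)) (Descent.M F (sharp n μ).1) ∧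
        Nonempty ((Descent.pullback F n s hs).obj
            (ModuleCat.of (Descent.descentAlgebra F n) (Descent.M F μ.1)) ≅
          ModuleCat.of (Descent.descentAlgebra F (n + s)) (Descent.M F (sharp n μ).1))) ∧
      Function.Injective (fun x : Σ n : ℕ, Descent.RegularPartition p n =>
        (⟨x.1 + s, sharp x.1 x.2⟩ : Σ n : ℕ, Descent.RegularPartition p n)) := by
  have hp : p = 0 ∨ p.Prime := (CharP.char_is_prime_or_zero F p).symm
  choose sharp hsharp using fun (n : ℕ) (μ : Descent.RegularPartition p n) =>
    Descent.exists_regular_pEquiv hp (Descent.appendPart μ.1 s hs)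
  have hw := fun n μ => (Descent.pEquiv_iff hp _ _).1 (hsharp n μ)
  refine ⟨sharp, fun n μ ν => ⟨fun h => ?_, fun h => h ▸ hsharp n μ⟩, fun n μ =>
    ⟨Descent.isSimpleModule_M F _, Descent.isSimpleModule_M F _,
      Descent.nonempty_pullback_iso F hs _ _ (Descent.char_eq_of_pEquiv F hp (hsharp n μ))⟩, ?_⟩
  -- Uniqueness: both regular partitions have the weights of the appended partition.
  · exact Descent.RegularPartition.eq_of_weight_eq hp fun m hm =>
      ((Descent.pEquiv_iff hp _ _).1 h m hm).trans (hw n μ m hm).symm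
  · rintro ⟨n, μ⟩ ⟨n', μ'⟩ h
    obtain ⟨h1, h2⟩ := Sigma.mk.inj h
    obtain rfl : n = n' := Nat.add_right_cancel h1
    have h3 := eq_of_heq h2
    congr 1
    refine Descent.RegularPartition.eq_of_weight_eq hp fun m hm => ?_
    -- Equal images force the two appended partitions to have equal weights; the contribution of the
    -- part `s` is the same on both sides and cancels.
    have h4 := (hw n μ m hm).symm.trans ((by rw [h3] : _ = _).trans (hw n μ' m hm))
    rw [Descent.appendPart, Descent.appendPart, Descent.weight_cons, Descent.weight_cons] at h4
    exact Nat.add_left_cancel h4
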